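/- Let $H(x,y)=\frac{y^2}{2}-\frac{x^2}{2}+\frac{x^4}{4}$ and, for $h>0$, let $\gamma(h)=\{(x,y)\in\mathbb{R}^2 : H(x,y)=h\}$ be the exterior oval of the Duffing oscillator $\dot x=y,\ \dot y=x-x^3$, oriented by this vector field. For every integer $n\ge 0$ the complete elliptic integral $$I_n(h)=\oint_{\gamma(h)}x^n y\,dx,\qquad h>0,$$ extends to a (necessarily unique) single-valued analytic function, still denoted $I_n$, on the domain $\mathcal D=\mathbb{C}\setminus(-\infty,0]$. For all $(\lambda_0,\lambda_2,\lambda_4)\in\mathbb{R}^3\setminus\{(0,0,0)\}$ the function $$M(h)=\lambda_0 I_0(h)+\lambda_2 I_2(h)+\lambda_4 I_4'(h),$$ the principal part of the first return map, has at most four zeros in $\mathcal D$, counted with multiplicity. -/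

import Mathlib

open Set

noncomputable section

/-- The Hamiltonian of the Duffing oscillator `x' = y`, `y' = x - x ^ 3`. -/
def duffingH (x y : ℝ) : ℝ := y ^ 2 / 2 - x ^ 2 / 2 + x ^ 4 / 4

/-- For `h > 0`, the abscissa of the rightmost point of the level curve `{duffingH = h}`. -/
def ovalEnd (h : ℝ) : ℝ := √(1 + √(1 + 4 * h))

/-- For `h > 0`, the upper half of the level curve `{duffingH = h}` is the graph of `ovalArc h`
over `[-ovalEnd h, ovalEnd h]`. -/
def ovalArc (h x : ℝ) : ℝ := √(2 * h + x ^ 2 - x ^ 4 / 2)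

/-- For `h > 0` the level curve of the Hamiltonian is the exterior oval, made of two arcs. -/
theorem duffingH_eq_iff {h : ℝ} (hh : 0 < h) (x y : ℝ) :
    duffingH x y = h ↔
      x ∈ Icc (-ovalEnd h) (ovalEnd h) ∧ (y = ovalArc h x ∨ y = -ovalArc h x) := by
  have hs : √(1 + 4 * h) ^ 2 = 1 + 4 * h := Real.sq_sqrt (by linarith)
  have hs0 : 1 < √(1 + 4 * h) := by
    rw [Real.lt_sqrt (by norm_num)]; linarith
  have key : 2 * h + x ^ 2 - x ^ 4 / 2 =
      (1 + √(1 + 4 * h) - x ^ 2) * (x ^ 2 + (√(1 + 4 * h) - 1)) / 2 := by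
    nlinarith
  have hpos : 0 < x ^ 2 + (√(1 + 4 * h) - 1) := by nlinarith [sq_nonneg x]
  have hend : x ∈ Icc (-ovalEnd h) (ovalEnd h) ↔ 0 ≤ 2 * h + x ^ 2 - x ^ 4 / 2 := by
    rw [mem_Icc, ← abs_le, ovalEnd, Real.le_sqrt (abs_nonneg x) (by linarith), sq_abs, key]
    constructor
    · intro hx
      have := mul_nonneg (sub_nonneg.2 hx) hpos.le
      linarith
    · intro hx
      by_contra hc
      have := mul_neg_of_neg_of_pos (sub_neg.2 (not_le.1 hc)) hpos
      linarith
  rw [hend, ovalArc, duffingH]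
  constructor
  · intro he
    have hy : 2 * h + x ^ 2 - x ^ 4 / 2 = y ^ 2 := by linarith
    rw [hy, Real.sqrt_sq_eq_abs]
    refine ⟨sq_nonneg y, ?_⟩
    rcases abs_choice y with h1 | h1
    · exact Or.inl h1.symm
    · right; linarith
  · rintro ⟨h0, hy⟩
    have hy2 : y ^ 2 = 2 * h + x ^ 2 - x ^ 4 / 2 := by
      rcases hy with rfl | rfl
      · exact Real.sq_sqrt h0
      · rw [neg_sq]; exact Real.sq_sqrt h0
    linarith

/-- The integral of the one-form `x ^ n * y dx` along the exterior oval `{duffingH = h}`, `h > 0`,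
oriented by the vector field `x' = y`, `y' = x - x ^ 3`: the upper arc is run through from left to
right, then the lower arc from right to left. -/
def ovalIntegral (n : ℕ) (h : ℝ) : ℝ :=
  (∫ x in (-ovalEnd h)..(ovalEnd h), x ^ n * ovalArc h x) +
    ∫ x in (ovalEnd h)..(-ovalEnd h), x ^ n * (-ovalArc h x)

/-- `I` is, on the cut plane `ℂ \ (-∞, 0]`, the single-valued analytic continuation of the Abelian integral
`h ↦ ∮ x ^ n y dx`, which is given on `(0, ∞)` as an integral along the exterior ovals. On the cut
plane such a function is unique by the identity theorem. -/
structure IsAbelianIntegral (n : ℕ) (I : ℂ → ℂ) : Prop where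
  analytic : AnalyticOnNhd ℂ I Complex.slitPlane
  eq_ovalIntegral : ∀ h : ℝ, 0 < h → I (h : ℂ) = (ovalIntegral n h : ℂ)

/-- The number of zeros of `f` in `U`, counted with multiplicity, for `f` analytic at the points of
`U`. It is `⊤` if there are infinitely many zeros or if `f` vanishes near a point of `U`. -/
def zeroCount (f : ℂ → ℂ) (U : Set ℂ) : ℕ∞ :=
  ⨆ S : {S : Finset ℂ // (S : Set ℂ) ⊆ U}, ∑ z ∈ S.1, analyticOrderAt f z

/-- The principal part `l0 * I0 + l2 * I2 + l4 * I4'` of the first return map. -/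
def principalPart (l0 l2 l4 : ℝ) (I0 I2 I4 : ℂ → ℂ) (h : ℂ) : ℂ :=
  l0 * I0 h + l2 * I2 h + l4 * deriv I4 h

end

open Set

open scoped Real Topology
open MeasureTheory

/-! ### The principal square root on the slit plane. -/

namespace Complex

/-! The exact forms `d(xy)` and `d(x³y)` give `I₄' = I₀ + I₂'` and `(4h + 1) I₂' = 5 I₂ - I₀`. Hence
`M = I₂' (α P + β + γ h)` with `P = I₀ / I₂'` (`quot`) and real `α, β, γ` depending injectively on
the `λ`'s. As `I₂'` has no zero in the cut plane, the zeros of `M` are the points where `P` meets a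
real affine function, unless `α = 0`, when a nonzero affine function remains.

With `s = √(1 + 4h)` and `x = √(s + 1) sin φ` the integrals extend to the cut plane as integrals
over a fixed interval (`ovalExt`). The signs of the integrands show that `P` maps the upper half
plane into itself and, by conjugation, the lower one too. Schwarz–Pick then allows one intersection,
of order one, in each open half plane (`affine_intersection`).

On the positive axis `P` is real and solves a Riccati equation. It is nondecreasing, by the half
plane property, and at most `√(1 + 4h)`; with these bounds `riccati_concave` proves it strictly
concave. So it meets a line there at most twice with multiplicity, and the total is `1 + 1 + 2 = 4`.
-/

theorem sqrt_sq_self (z : ℂ) : sqrt z ^ 2 = z := by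
  have := cpow_nat_inv_pow z (n := 2) two_ne_zero
  simp only [Nat.cast_ofNat] at this
  exact this

theorem sqrt_ne_zero {z : ℂ} (hz : z ≠ 0) : sqrt z ≠ 0 := by
  intro h
  apply hz
  rw [← sqrt_sq_self z, h]
  simp

theorem hasDerivAt_sqrt_inv {z : ℂ} (hz : z ∈ slitPlane) :
    HasDerivAt sqrt (1 / (2 * sqrt z)) z := by
  refine (hasDerivAt_sqrt hz).congr_deriv ?_
  have hz0 := slitPlane_ne_zero hz
  rw [show (-1 / 2 : ℂ) = -(2⁻¹) by norm_num, cpow_neg, sqrt]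
  field_simp

theorem sqrt_re_pos {z : ℂ} (hz : z ∈ slitPlane) : 0 < (sqrt z).re := by
  rw [sqrt, cpow_inv_two_re]
  apply Real.sqrt_pos.2
  have : -z.re < ‖z‖ := by
    rcases hz with h | h
    · have := norm_nonneg z
      linarith
    · have := abs_re_lt_norm.2 h
      exact (neg_le_abs _).trans_lt this
  linarith

theorem sqrt_im_pos {z : ℂ} (hz : 0 < z.im) : 0 < (sqrt z).im := by
  rw [sqrt, cpow_inv_two_im_eq_sqrt hz.le]
  apply Real.sqrt_pos.2
  have := (le_abs_self _).trans_lt (abs_re_lt_norm.2 hz.ne')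
  linarith

theorem sqrt_im_neg {z : ℂ} (hz : z.im < 0) : (sqrt z).im < 0 := by
  rw [sqrt, cpow_inv_two_im_eq_neg_sqrt hz, neg_lt_zero]
  apply Real.sqrt_pos.2
  have := (le_abs_self _).trans_lt (abs_re_lt_norm.2 hz.ne)
  linarith

theorem sqrt_ofReal_of_nonneg {x : ℝ} (hx : 0 ≤ x) : sqrt (x : ℂ) = (√x : ℝ) := by
  rw [sqrt_of_nonneg (by exact_mod_cast hx), ofReal_re]

end Complex

/-! ### The elliptic integrals over a fixed interval in `φ`. -/

namespace Duffing

open Complex ComplexConjugate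

/-- With `x = √(s + 1) * sin φ` one has `y ^ 2 = (s + 1) * cos φ ^ 2 * radicand s φ / 2` on the level
curve `{duffingH = h}`, where `s = √(1 + 4 * h)`. -/
noncomputable def radicand (s : ℂ) (φ : ℝ) : ℂ := (s + 1) * (Real.sin φ : ℂ) ^ 2 + (s - 1)

theorem radicand_re (s : ℂ) (φ : ℝ) :
    (radicand s φ).re = (s.re + 1) * Real.sin φ ^ 2 + (s.re - 1) := by
  simp [radicand, ← ofReal_pow, -ofReal_sin]

theorem radicand_im (s : ℂ) (φ : ℝ) : (radicand s φ).im = s.im * (1 + Real.sin φ ^ 2) := by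
  simp [radicand, ← ofReal_pow, -ofReal_sin]
  ring

/-- Off the real axis `radicand s φ` has the sign of `s.im` in its imaginary part; for `1 < s.re`
its real part is positive. So the principal root never meets its cut. -/
theorem radicand_mem {s : ℂ} (hs : s - 1 ∈ slitPlane) (φ : ℝ) : radicand s φ ∈ slitPlane := by
  rw [mem_slitPlane_iff, radicand_re, radicand_im]
  rcases hs with h | h
  · left
    simp at h
    have : 0 ≤ (s.re + 1) * Real.sin φ ^ 2 := by positivity
    linarith
  · right
    simp at h
    exact mul_ne_zero h (by positivity)

theorem sqrt_radicand_ne_zero {s : ℂ} (hs : s - 1 ∈ slitPlane) (φ : ℝ) :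
    sqrt (radicand s φ) ≠ 0 :=
  sqrt_ne_zero (slitPlane_ne_zero (radicand_mem hs φ))

theorem continuous_sqrt_radicand {s : ℂ} (hs : s - 1 ∈ slitPlane) :
    Continuous fun φ => sqrt (radicand s φ) := by
  refine continuousOn_sqrt.comp_continuous ?_ (radicand_mem hs)
  unfold radicand
  fun_prop

theorem isOpen_domain : IsOpen {s : ℂ | s - 1 ∈ slitPlane} :=
  isOpen_slitPlane.preimage (by fun_prop)

/-- The integral `∮ x ^ n y dx` up to a power of `s + 1`. -/
noncomputable def cosInt (n : ℕ) (s : ℂ) : ℂ :=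
  ∫ φ in (-(π / 2))..(π / 2),
    (Real.sin φ : ℂ) ^ n * (Real.cos φ : ℂ) ^ 2 * sqrt (radicand s φ)

/-- The integral `∮ x ^ n dx / y` up to a power of `s + 1`. -/
noncomputable def invInt (n : ℕ) (s : ℂ) : ℂ :=
  ∫ φ in (-(π / 2))..(π / 2), (Real.sin φ : ℂ) ^ n / sqrt (radicand s φ)

theorem continuous_invInt_integrand (n : ℕ) {s : ℂ} (hs : s - 1 ∈ slitPlane) :
    Continuous fun φ : ℝ => (Real.sin φ : ℂ) ^ n / sqrt (radicand s φ) :=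
  Continuous.div (by fun_prop) (continuous_sqrt_radicand hs) (sqrt_radicand_ne_zero hs)

theorem continuous_cosInt_integrand (n : ℕ) {s : ℂ} (hs : s - 1 ∈ slitPlane) :
    Continuous fun φ : ℝ =>
      (Real.sin φ : ℂ) ^ n * (Real.cos φ : ℂ) ^ 2 * sqrt (radicand s φ) :=
  Continuous.mul (by fun_prop) (continuous_sqrt_radicand hs)

theorem cos_sq_eq (φ : ℝ) : (Real.cos φ : ℂ) ^ 2 = 1 - (Real.sin φ : ℂ) ^ 2 := by
  have := Real.sin_sq_add_cos_sq φ
  rw [eq_sub_iff_add_eq]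
  exact_mod_cast (by linarith : Real.cos φ ^ 2 + Real.sin φ ^ 2 = 1)

theorem cosInt_eq (n : ℕ) {s : ℂ} (hs : s - 1 ∈ slitPlane) :
    cosInt n s = (s - 1) * invInt n s + 2 * invInt (n + 2) s - (s + 1) * invInt (n + 4) s := by
  have hi := fun m => (continuous_invInt_integrand m hs).intervalIntegrable
    (μ := volume) (-(π / 2)) (π / 2)
  unfold cosInt invInt
  rw [← intervalIntegral.integral_const_mul, ← intervalIntegral.integral_const_mul,
    ← intervalIntegral.integral_const_mul,
    ← intervalIntegral.integral_add ((hi _).const_mul _) ((hi _).const_mul _),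
    ← intervalIntegral.integral_sub (((hi _).const_mul _).add ((hi _).const_mul _))
      ((hi _).const_mul _)]
  refine intervalIntegral.integral_congr fun φ _ => ?_
  have h0 := sqrt_radicand_ne_zero hs φ
  have h2 := sqrt_sq_self (radicand s φ)
  simp only [cos_sq_eq]
  field_simp
  rw [h2, radicand]
  ring

theorem hasDerivAt_sqrt_radicand {s : ℂ} (hs : s - 1 ∈ slitPlane) (φ : ℝ) :
    HasDerivAt (fun s => sqrt (radicand s φ))
      ((1 + (Real.sin φ : ℂ) ^ 2) / (2 * sqrt (radicand s φ))) s := by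
  have h1 : HasDerivAt (fun s => radicand s φ) ((Real.sin φ : ℂ) ^ 2 + 1) s := by
    unfold radicand
    exact ((((hasDerivAt_id s).add_const 1).mul_const _).add
      ((hasDerivAt_id s).sub_const 1)).congr_deriv (by ring)
  refine ((hasDerivAt_sqrt_inv (radicand_mem hs φ)).comp s h1).congr_deriv ?_
  ring

theorem hasDerivAt_cosInt (n : ℕ) {s : ℂ} (hs : s - 1 ∈ slitPlane) :
    HasDerivAt (cosInt n) ((invInt n s - invInt (n + 4) s) / 2) s := by
  set F' : ℂ → ℝ → ℂ := fun s φ => (Real.sin φ : ℂ) ^ n * (Real.cos φ : ℂ) ^ 2 *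
    ((1 + (Real.sin φ : ℂ) ^ 2) / (2 * sqrt (radicand s φ))) with hF'
  -- A closed ball makes the parameter set compact, so the `s`-derivative of the integrand has a
  -- constant bound.
  obtain ⟨ε, hε, hball⟩ := Metric.nhds_basis_closedBall.mem_iff.1 (isOpen_domain.mem_nhds hs)
  have hcont : ContinuousOn (fun p : ℂ × ℝ => F' p.1 p.2)
      (Metric.closedBall s ε ×ˢ Icc (-(π / 2)) (π / 2)) := by
    have hsq : ContinuousOn (fun p : ℂ × ℝ => sqrt (radicand p.1 p.2))
        (Metric.closedBall s ε ×ˢ Icc (-(π / 2)) (π / 2)) := by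
      refine continuousOn_sqrt.comp ?_ fun p hp => radicand_mem (hball hp.1) p.2
      unfold radicand
      fun_prop
    refine ContinuousOn.mul (by fun_prop) (ContinuousOn.div (by fun_prop) (by fun_prop) ?_)
    intro p hp
    exact mul_ne_zero two_ne_zero (sqrt_radicand_ne_zero (hball hp.1) p.2)
  obtain ⟨C, hC⟩ := ((isCompact_closedBall s ε).prod isCompact_Icc).exists_bound_of_continuousOn
    hcont
  have hpi : -(π / 2) ≤ π / 2 := by linarith [Real.pi_pos]
  have hF'c : Continuous (F' s) :=
    Continuous.mul (by fun_prop) (Continuous.div (by fun_prop)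
      (continuous_const.mul (continuous_sqrt_radicand hs))
      fun φ => mul_ne_zero two_ne_zero (sqrt_radicand_ne_zero hs φ))
  have key := intervalIntegral.hasDerivAt_integral_of_dominated_loc_of_deriv_le
    (μ := volume) (a := -(π / 2)) (b := π / 2)
    (F := fun s φ => (Real.sin φ : ℂ) ^ n * (Real.cos φ : ℂ) ^ 2 * sqrt (radicand s φ))
    (F' := F') (x₀ := s) (bound := fun _ => C) (Metric.closedBall_mem_nhds s hε)
    (by
      filter_upwards [isOpen_domain.mem_nhds hs] with x hx
      exact (continuous_cosInt_integrand n hx).aestronglyMeasurable)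
    ((continuous_cosInt_integrand n hs).intervalIntegrable _ _)
    hF'c.aestronglyMeasurable
    (by
      refine Filter.Eventually.of_forall fun t ht x hx => hC (x, t) ⟨hx, ?_⟩
      rw [uIoc_of_le hpi] at ht
      exact ⟨ht.1.le, ht.2⟩)
    (by simp)
    (Filter.Eventually.of_forall fun t _ x hx =>
      (hasDerivAt_sqrt_radicand (hball hx) t).const_mul _)
  refine key.2.congr_deriv ?_
  have hi := fun m => (continuous_invInt_integrand m hs).intervalIntegrable
    (μ := volume) (-(π / 2)) (π / 2)
  unfold invInt
  rw [← intervalIntegral.integral_sub (hi _) (hi _), ← intervalIntegral.integral_div]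
  refine intervalIntegral.integral_congr fun φ _ => ?_
  have h0 := sqrt_radicand_ne_zero hs φ
  simp only [hF', cos_sq_eq]
  field_simp
  ring

/-- The recursion given by the exact form `d (sin φ ^ (n + 1) * cos φ * √(radicand s φ))`. -/
theorem invInt_rec (n : ℕ) {s : ℂ} (hs : s - 1 ∈ slitPlane) :
    (n + 1) * (s - 1) * invInt n s + 2 * (n + 2) * invInt (n + 2) s
      - (n + 3) * (s + 1) * invInt (n + 4) s = 0 := by
  have hi := fun m => (continuous_invInt_integrand m hs).intervalIntegrable
    (μ := volume) (-(π / 2)) (π / 2)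
  have hsin : ∀ φ : ℝ, HasDerivAt (fun φ : ℝ => (Real.sin φ : ℂ)) (Real.cos φ : ℂ) φ :=
    fun φ => (Real.hasDerivAt_sin φ).ofReal_comp
  have hcos : ∀ φ : ℝ, HasDerivAt (fun φ : ℝ => (Real.cos φ : ℂ)) (-(Real.sin φ : ℂ)) φ :=
    fun φ => by simpa using (Real.hasDerivAt_cos φ).ofReal_comp
  have hrad : ∀ φ : ℝ, HasDerivAt (fun φ : ℝ => radicand s φ)
      ((s + 1) * (2 * (Real.sin φ : ℂ) * (Real.cos φ : ℂ))) φ := fun φ => by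
    unfold radicand
    exact ((((hsin φ).pow 2).const_mul (s + 1)).add_const (s - 1)).congr_deriv
      (by push_cast; ring)
  have hsqrt : ∀ φ : ℝ, HasDerivAt (fun φ : ℝ => sqrt (radicand s φ))
      (1 / (2 * sqrt (radicand s φ)) * ((s + 1) * (2 * (Real.sin φ : ℂ) * (Real.cos φ : ℂ)))) φ :=
    fun φ => HasDerivAt.comp φ (hasDerivAt_sqrt_inv (radicand_mem hs φ)) (hrad φ)
  have hD : ∀ φ : ℝ, HasDerivAt
      (fun φ : ℝ => (Real.sin φ : ℂ) ^ (n + 1) * (Real.cos φ : ℂ) * sqrt (radicand s φ))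
      ((n + 1) * (s - 1) * ((Real.sin φ : ℂ) ^ n / sqrt (radicand s φ))
        + 2 * (n + 2) * ((Real.sin φ : ℂ) ^ (n + 2) / sqrt (radicand s φ))
        - (n + 3) * (s + 1) * ((Real.sin φ : ℂ) ^ (n + 4) / sqrt (radicand s φ))) φ := fun φ => by
    refine ((((hsin φ).pow (n + 1)).mul (hcos φ)).mul (hsqrt φ)).congr_deriv ?_
    have h0 := sqrt_radicand_ne_zero hs φ
    have h2 := sqrt_sq_self (radicand s φ)
    have hc := cos_sq_eq φ
    simp only [Pi.mul_apply, Pi.pow_apply, Nat.add_sub_cancel]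
    generalize hS : (Real.sin φ : ℂ) = S at *
    generalize hC : (Real.cos φ : ℂ) = C at *
    generalize hR : sqrt (radicand s φ) = R at *
    have h2' : R ^ 2 = (s + 1) * S ^ 2 + (s - 1) := by rw [h2, radicand, hS]
    field_simp
    push_cast
    linear_combination ((n + 1 : ℂ) * S ^ n * C ^ 2 - S ^ (n + 2)) * h2' +
      ((n + 1 : ℂ) * S ^ n * ((s + 1) * S ^ 2 + (s - 1)) + S ^ (n + 2) * (s + 1)) * hc
  have hint := intervalIntegral.integral_eq_sub_of_hasDerivAt (a := -(π / 2)) (b := π / 2)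
    (fun φ _ => hD φ) ((((hi _).const_mul _).add ((hi _).const_mul _)).sub ((hi _).const_mul _))
  rw [intervalIntegral.integral_sub (((hi _).const_mul _).add ((hi _).const_mul _))
      ((hi _).const_mul _), intervalIntegral.integral_add ((hi _).const_mul _) ((hi _).const_mul _),
    intervalIntegral.integral_const_mul, intervalIntegral.integral_const_mul,
    intervalIntegral.integral_const_mul] at hint
  unfold invInt
  rw [hint]
  -- The boundary terms vanish because `cos (±π / 2) = 0`.
  simp [-ofReal_cos, -ofReal_sin]

/-! ### Signs, conjugation symmetry and a real bound for the integrals. -/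

theorem pos_of_integral_pos {F : ℝ → ℂ} (hF : Continuous F) (l : ℂ →L[ℝ] ℝ)
    (h0 : ∀ φ, 0 ≤ l (F φ)) {c : ℝ} (hc : c ∈ Icc (-(π / 2)) (π / 2)) (h1 : 0 < l (F c)) :
    0 < l (∫ φ in (-(π / 2))..(π / 2), F φ) := by
  rw [← l.intervalIntegral_comp_comm (hF.intervalIntegrable _ _)]
  exact intervalIntegral.integral_pos (by linarith [Real.pi_pos])
    (l.continuous.comp hF).continuousOn (fun x _ => h0 x) ⟨c, hc, h1⟩

theorem zero_mem : (0 : ℝ) ∈ Icc (-(π / 2)) (π / 2) := by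
  constructor <;> linarith [Real.pi_pos]

theorem pi_div_two_mem : π / 2 ∈ Icc (-(π / 2)) (π / 2) := by
  constructor <;> linarith [Real.pi_pos]

theorem cosInt_zero_re_pos {s : ℂ} (hs : s - 1 ∈ slitPlane) : 0 < (cosInt 0 s).re := by
  have hr : ∀ φ : ℝ, ((Real.sin φ : ℂ) ^ 0 * (Real.cos φ : ℂ) ^ 2 * sqrt (radicand s φ)).re =
      Real.cos φ ^ 2 * (sqrt (radicand s φ)).re := fun φ => by
    rw [pow_zero, one_mul, ← ofReal_pow, re_ofReal_mul]
  have hp := fun φ => sqrt_re_pos (radicand_mem hs φ)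
  refine pos_of_integral_pos (continuous_cosInt_integrand 0 hs) reCLM (fun φ => ?_) zero_mem ?_
  · rw [reCLM_apply, hr]
    exact mul_nonneg (sq_nonneg _) (hp φ).le
  · rw [reCLM_apply, hr, Real.cos_zero]
    simpa using hp 0

theorem cosInt_zero_im_pos {s : ℂ} (hs : 0 < s.im) : 0 < (cosInt 0 s).im := by
  have hr : ∀ φ : ℝ, ((Real.sin φ : ℂ) ^ 0 * (Real.cos φ : ℂ) ^ 2 * sqrt (radicand s φ)).im =
      Real.cos φ ^ 2 * (sqrt (radicand s φ)).im := fun φ => by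
    rw [pow_zero, one_mul, ← ofReal_pow, im_ofReal_mul]
  have hs' : s - 1 ∈ slitPlane := Or.inr (by simpa using hs.ne')
  have hp : ∀ φ, 0 < (sqrt (radicand s φ)).im := fun φ =>
    sqrt_im_pos (by rw [radicand_im]; positivity)
  refine pos_of_integral_pos (continuous_cosInt_integrand 0 hs') imCLM (fun φ => ?_) zero_mem ?_
  · rw [imCLM_apply, hr]
    exact mul_nonneg (sq_nonneg _) (hp φ).le
  · rw [imCLM_apply, hr, Real.cos_zero]
    simpa using hp 0

theorem invInt_re_pos {n : ℕ} (hn : Even n) {s : ℂ} (hs : s - 1 ∈ slitPlane) :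
    0 < (invInt n s).re := by
  have hr : ∀ φ : ℝ, ((Real.sin φ : ℂ) ^ n / sqrt (radicand s φ)).re =
      Real.sin φ ^ n * ((sqrt (radicand s φ)).re / normSq (sqrt (radicand s φ))) := fun φ => by
    rw [div_eq_mul_inv, ← ofReal_pow, re_ofReal_mul, inv_re]
  have hp : ∀ φ, 0 < (sqrt (radicand s φ)).re / normSq (sqrt (radicand s φ)) := fun φ =>
    div_pos (sqrt_re_pos (radicand_mem hs φ)) (normSq_pos.2 (sqrt_radicand_ne_zero hs φ))
  -- Strict positivity is tested at `π / 2`, since `sin φ ^ n` vanishes at `0` when `n > 0`.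
  refine pos_of_integral_pos (continuous_invInt_integrand n hs) reCLM (fun φ => ?_)
    pi_div_two_mem ?_
  · rw [reCLM_apply, hr]
    exact mul_nonneg (hn.pow_nonneg _) (hp φ).le
  · rw [reCLM_apply, hr, Real.sin_pi_div_two, one_pow, one_mul]
    exact hp _

theorem invInt_im_neg {n : ℕ} (hn : Even n) {s : ℂ} (hs : 0 < s.im) :
    (invInt n s).im < 0 := by
  have hr : ∀ φ : ℝ, ((Real.sin φ : ℂ) ^ n / sqrt (radicand s φ)).im =
      Real.sin φ ^ n * -((sqrt (radicand s φ)).im / normSq (sqrt (radicand s φ))) := fun φ => by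
    rw [div_eq_mul_inv, ← ofReal_pow, im_ofReal_mul, inv_im, neg_div]
  have hs' : s - 1 ∈ slitPlane := Or.inr (by simpa using hs.ne')
  have hp : ∀ φ, 0 < (sqrt (radicand s φ)).im / normSq (sqrt (radicand s φ)) := fun φ =>
    div_pos (sqrt_im_pos (by rw [radicand_im]; positivity))
      (normSq_pos.2 (sqrt_radicand_ne_zero hs' φ))
  have := pos_of_integral_pos (continuous_invInt_integrand n hs') (-imCLM) (fun φ => ?_)
    pi_div_two_mem ?_
  · simpa [invInt] using this
  · rw [neg_apply, imCLM_apply, hr, mul_neg, neg_neg]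
    exact mul_nonneg (hn.pow_nonneg _) (hp φ).le
  · rw [neg_apply, imCLM_apply, hr, Real.sin_pi_div_two, one_pow, one_mul,
      neg_neg]
    exact hp _

theorem sqrt_conj {z : ℂ} (hz : z ∈ slitPlane) :
    sqrt (conj z) = conj (sqrt z) := by
  have := conj_cpow z (2⁻¹ : ℂ) (slitPlane_arg_ne_pi hz)
  rwa [map_inv₀, map_ofNat] at this

theorem radicand_conj (s : ℂ) (φ : ℝ) :
    radicand (conj s) φ = conj (radicand s φ) := by
  simp only [radicand, map_add, map_sub, map_mul, map_pow, map_one, conj_ofReal]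

theorem cosInt_conj (n : ℕ) {s : ℂ} (hs : s - 1 ∈ slitPlane) :
    cosInt n (conj s) = conj (cosInt n s) := by
  unfold cosInt
  rw [← intervalIntegral.intervalIntegral_conj]
  refine intervalIntegral.integral_congr fun φ _ => ?_
  simp only [map_mul, map_pow, conj_ofReal, radicand_conj, sqrt_conj (radicand_mem hs φ)]

theorem invInt_conj (n : ℕ) {s : ℂ} (hs : s - 1 ∈ slitPlane) :
    invInt n (conj s) = conj (invInt n s) := by
  unfold invInt
  rw [← intervalIntegral.intervalIntegral_conj]
  refine intervalIntegral.integral_congr fun φ _ => ?_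
  simp only [map_div₀, map_pow, conj_ofReal, radicand_conj, sqrt_conj (radicand_mem hs φ)]

/-- The upper bound of `cosInt 0 / invInt 2` on the real axis. -/
theorem cosInt_zero_le {s : ℝ} (hs : 1 < s) :
    (cosInt 0 s).re ≤ 2 * s * (invInt 2 s).re := by
  have hs' : (s : ℂ) - 1 ∈ slitPlane := Or.inl (by simpa using hs)
  have hrad : ∀ φ : ℝ, 0 < (s + 1) * Real.sin φ ^ 2 + (s - 1) := fun φ => by
    have : 0 ≤ (s + 1) * Real.sin φ ^ 2 := by positivity
    linarith
  have hsq : ∀ φ : ℝ, sqrt (radicand s φ) = (√((s + 1) * Real.sin φ ^ 2 + (s - 1)) : ℝ) :=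
    fun φ => by
    rw [← sqrt_ofReal_of_nonneg (hrad φ).le, radicand]
    push_cast
    rfl
  have hc : (cosInt 0 s).re = ∫ φ in (-(π / 2))..(π / 2),
      Real.cos φ ^ 2 * √((s + 1) * Real.sin φ ^ 2 + (s - 1)) := by
    rw [cosInt, ← reCLM_apply, ← reCLM.intervalIntegral_comp_comm
      ((continuous_cosInt_integrand 0 hs').intervalIntegrable _ _)]
    refine intervalIntegral.integral_congr fun φ _ => ?_
    simp only [reCLM_apply, hsq, pow_zero, one_mul, ← ofReal_pow, ← ofReal_mul, ofReal_re]
  have hi : (invInt 2 s).re = ∫ φ in (-(π / 2))..(π / 2),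
      Real.sin φ ^ 2 / √((s + 1) * Real.sin φ ^ 2 + (s - 1)) := by
    rw [invInt, ← reCLM_apply, ← reCLM.intervalIntegral_comp_comm
      ((continuous_invInt_integrand 2 hs').intervalIntegrable _ _)]
    refine intervalIntegral.integral_congr fun φ _ => ?_
    simp only [reCLM_apply, hsq, ← ofReal_pow, ← ofReal_div, ofReal_re]
  have hpi : -(π / 2) ≤ π / 2 := by linarith [Real.pi_pos]
  -- The radicand is largest at `sin φ ^ 2 = 1`. Replacing the root by this maximum bounds `cosInt
  -- 0` above and `invInt 2` below by elementary integrals.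
  have hle : ∀ φ : ℝ, √((s + 1) * Real.sin φ ^ 2 + (s - 1)) ≤ √(2 * s) := fun φ => by
    apply Real.sqrt_le_sqrt
    nlinarith [Real.sin_sq_le_one φ]
  have hpos : 0 < √(2 * s) := Real.sqrt_pos.2 (by linarith)
  have h1 : (cosInt 0 s).re ≤ √(2 * s) * (π / 2) := by
    have : √(2 * s) * (π / 2) = ∫ φ in (-(π / 2))..(π / 2), Real.cos φ ^ 2 * √(2 * s) := by
      rw [intervalIntegral.integral_mul_const, integral_cos_sq]
      simp
      ring
    rw [this, hc]
    refine intervalIntegral.integral_mono_on hpi (Continuous.intervalIntegrable (by fun_prop) _ _)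
      (Continuous.intervalIntegrable (by fun_prop) _ _) fun φ _ => ?_
    exact mul_le_mul_of_nonneg_left (hle φ) (sq_nonneg _)
  have h2 : π / 2 / √(2 * s) ≤ (invInt 2 s).re := by
    have : π / 2 / √(2 * s) = ∫ φ in (-(π / 2))..(π / 2), Real.sin φ ^ 2 / √(2 * s) := by
      rw [intervalIntegral.integral_div, integral_sin_sq]
      simp
    rw [this, hi]
    have h0 : ∀ φ, 0 < √((s + 1) * Real.sin φ ^ 2 + (s - 1)) := fun φ => Real.sqrt_pos.2 (hrad φ)
    refine intervalIntegral.integral_mono_on hpi (Continuous.intervalIntegrable (by fun_prop) _ _)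
      (Continuous.intervalIntegrable (Continuous.div (by fun_prop) (by fun_prop)
        fun φ => (h0 φ).ne') _ _) fun φ _ => ?_
    exact div_le_div_of_nonneg_left (sq_nonneg _) (h0 φ) (hle φ)
  have h3 : 2 * s * (π / 2 / √(2 * s)) = √(2 * s) * (π / 2) := by
    have := Real.sq_sqrt (show 0 ≤ 2 * s by linarith)
    field_simp
    linarith
  calc _ ≤ √(2 * s) * (π / 2) := h1
    _ = 2 * s * (π / 2 / √(2 * s)) := h3.symm
    _ ≤ _ := mul_le_mul_of_nonneg_left h2 (by linarith)

/-! ### The coordinate `s` and the continuation of the Abelian integrals. -/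

/-- The coordinate `√(1 + 4 * h)`. -/
noncomputable def rootParam (h : ℂ) : ℂ := sqrt (1 + 4 * h)

theorem one_add_mem {h : ℂ} (hh : h ∈ slitPlane) : 1 + 4 * h ∈ slitPlane := by
  rcases hh with h1 | h1
  · left; simp; linarith
  · right; simpa using h1

theorem rootParam_sq (h : ℂ) : rootParam h ^ 2 = 1 + 4 * h := sqrt_sq_self _

theorem rootParam_re_pos {h : ℂ} (hh : h ∈ slitPlane) : 0 < (rootParam h).re :=
  sqrt_re_pos (one_add_mem hh)

theorem rootParam_im_pos {h : ℂ} (hh : 0 < h.im) : 0 < (rootParam h).im :=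
  sqrt_im_pos (by simpa using hh)

theorem rootParam_ofReal {x : ℝ} (hx : 0 < x) : rootParam x = (√(1 + 4 * x) : ℝ) := by
  rw [rootParam, ← sqrt_ofReal_of_nonneg (by linarith)]
  push_cast
  rfl

theorem one_lt_sqrt {x : ℝ} (hx : 0 < x) : 1 < √(1 + 4 * x) := by
  rw [Real.lt_sqrt (by norm_num)]
  linarith

theorem rootParam_sub_one_mem {h : ℂ} (hh : h ∈ slitPlane) : rootParam h - 1 ∈ slitPlane := by
  rcases lt_trichotomy h.im 0 with h1 | h1 | h1
  · have : (rootParam h).im < 0 := sqrt_im_neg (by simp; linarith)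
    exact Or.inr (by simpa using this.ne)
  · obtain ⟨x, rfl⟩ : ∃ x : ℝ, h = x := ⟨h.re, Complex.ext rfl (by simpa using h1)⟩
    have hx : 0 < x := by simpa [mem_slitPlane_iff] using hh
    rw [rootParam_ofReal hx]
    exact Or.inl (by simpa using one_lt_sqrt hx)
  · exact Or.inr (by simpa using (rootParam_im_pos h1).ne')

theorem rootParam_add_one_mem {h : ℂ} (hh : h ∈ slitPlane) : rootParam h + 1 ∈ slitPlane :=
  Or.inl (by have := rootParam_re_pos hh; simp; linarith)

theorem rootParam_ne_zero {h : ℂ} (hh : h ∈ slitPlane) : rootParam h ≠ 0 := by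
  intro h0
  have := rootParam_re_pos hh
  simp [h0] at this

theorem hasDerivAt_rootParam {h : ℂ} (hh : h ∈ slitPlane) :
    HasDerivAt rootParam (2 / rootParam h) h := by
  have h1 : HasDerivAt (fun h : ℂ => 1 + 4 * h) 4 h :=
    (((hasDerivAt_id h).const_mul 4).const_add 1).congr_deriv (by ring)
  refine ((hasDerivAt_sqrt_inv (one_add_mem hh)).comp h h1).congr_deriv ?_
  rw [← rootParam]
  have := rootParam_ne_zero hh
  field_simp
  norm_num

/-- The analytic continuation of `ovalIntegral n` to the cut plane. -/
noncomputable def ovalExt (n : ℕ) (h : ℂ) : ℂ :=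
  √2 * sqrt (rootParam h + 1) ^ (n + 2) * cosInt n (rootParam h)

/-- This is `Iₙ' = ∮ xⁿ dx / y`. The derivatives of the prefactor and of `cosInt` combine, modulo
`invInt_rec`, into a multiple of `invInt n` alone. -/
theorem hasDerivAt_ovalExt (n : ℕ) {h : ℂ} (hh : h ∈ slitPlane) :
    HasDerivAt (ovalExt n) (2 * √2 * sqrt (rootParam h + 1) ^ n * invInt n (rootParam h)) h := by
  have hs := rootParam_sub_one_mem hh
  have hd := hasDerivAt_rootParam hh
  have ha : HasDerivAt (fun h => sqrt (rootParam h + 1))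
      (1 / (2 * sqrt (rootParam h + 1)) * (2 / rootParam h)) h :=
    HasDerivAt.comp h (hasDerivAt_sqrt_inv (rootParam_add_one_mem hh)) (hd.add_const 1)
  have hK : HasDerivAt (fun h => cosInt n (rootParam h))
      ((invInt n (rootParam h) - invInt (n + 4) (rootParam h)) / 2 * (2 / rootParam h)) h :=
    HasDerivAt.comp h (hasDerivAt_cosInt n hs) hd
  refine (((ha.pow (n + 2)).const_mul (√2 : ℂ)).mul hK).congr_deriv ?_
  have h0 := rootParam_ne_zero hh
  have ha0 := sqrt_ne_zero (slitPlane_ne_zero (rootParam_add_one_mem hh))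
  have ha2 := sqrt_sq_self (rootParam h + 1)
  have hrec := invInt_rec n hs
  have hcos := cosInt_eq n hs
  simp only [Pi.pow_apply, hcos]
  generalize sqrt (rootParam h + 1) = a at *
  generalize rootParam h = s at *
  generalize invInt n s = L0 at *
  generalize invInt (n + 2) s = L2 at *
  generalize invInt (n + 4) s = L4 at *
  have hs' : s = a ^ 2 - 1 := by rw [ha2]; ring
  subst hs'
  rw [show n + 2 - 1 = n + 1 by omega]
  field_simp
  push_cast
  linear_combination (a ^ n * a) * hrec

theorem analyticOnNhd_of_hasDerivAt {f f' : ℂ → ℂ} {U : Set ℂ} (hU : IsOpen U)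
    (hf : ∀ z ∈ U, HasDerivAt f (f' z) z) : AnalyticOnNhd ℂ f U :=
  DifferentiableOn.analyticOnNhd
    (fun z hz => (hf z hz).differentiableAt.differentiableWithinAt) hU

theorem ovalIntegral_eq (n : ℕ) (h : ℝ) :
    ovalIntegral n h = 2 * ∫ x in (-ovalEnd h)..(ovalEnd h), x ^ n * ovalArc h x := by
  rw [ovalIntegral, intervalIntegral.integral_symm (-ovalEnd h) (ovalEnd h)]
  simp only [mul_neg, intervalIntegral.integral_neg, neg_neg]
  ring

/-- With `s = √(1 + 4h)`, `2h + x² - x⁴/2 = (s + 1 - x²)(x² + s - 1) / 2`, and the substitution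
turns the first factor into `(s + 1) cos² φ`. -/
theorem ovalArc_sin {h : ℝ} (hh : 0 < h) {φ : ℝ} (hφ : φ ∈ Icc (-(π / 2)) (π / 2)) :
    ovalArc h (ovalEnd h * Real.sin φ) = ovalEnd h * Real.cos φ *
      √((√(1 + 4 * h) + 1) * Real.sin φ ^ 2 + (√(1 + 4 * h) - 1)) / √2 := by
  have hs : √(1 + 4 * h) ^ 2 = 1 + 4 * h := Real.sq_sqrt (by linarith)
  have ha : ovalEnd h ^ 2 = 1 + √(1 + 4 * h) := Real.sq_sqrt (by positivity)
  have ha0 : 0 ≤ ovalEnd h := Real.sqrt_nonneg _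
  have hc0 : 0 ≤ Real.cos φ := Real.cos_nonneg_of_mem_Icc hφ
  have h1 := one_lt_sqrt hh
  have hr : 0 ≤ (√(1 + 4 * h) + 1) * Real.sin φ ^ 2 + (√(1 + 4 * h) - 1) := by
    have : 0 ≤ (√(1 + 4 * h) + 1) * Real.sin φ ^ 2 := by positivity
    linarith
  have hc := Real.sin_sq_add_cos_sq φ
  rw [ovalArc]
  refine Eq.trans (congrArg _ ?_) (Real.sqrt_sq (by positivity))
  rw [div_pow, mul_pow _ √(_ + _), mul_pow _ (Real.cos φ), mul_pow, mul_pow, Real.sq_sqrt hr,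
    Real.sq_sqrt zero_le_two, show ovalEnd h ^ 4 = (ovalEnd h ^ 2) ^ 2 by ring, ha]
  generalize √(1 + 4 * h) = s at *
  generalize Real.sin φ = S at *
  rw [show Real.cos φ ^ 2 = 1 - S ^ 2 by linarith]
  linear_combination (-(1 / 2) : ℝ) * hs

theorem ovalExt_ofReal (n : ℕ) {h : ℝ} (hh : 0 < h) : ovalExt n h = ovalIntegral n h := by
  have h1 := one_lt_sqrt hh
  have hr : ∀ φ, 0 ≤ (√(1 + 4 * h) + 1) * Real.sin φ ^ 2 + (√(1 + 4 * h) - 1) := fun φ => by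
    have : 0 ≤ (√(1 + 4 * h) + 1) * Real.sin φ ^ 2 := by positivity
    linarith
  have hend : sqrt (rootParam h + 1) = (ovalEnd h : ℂ) := by
    rw [rootParam_ofReal hh, ovalEnd, ← ofReal_one, ← ofReal_add,
      sqrt_ofReal_of_nonneg (by positivity), add_comm]
  have hsub : ∫ x in (-ovalEnd h)..(ovalEnd h), x ^ n * ovalArc h x =
      ∫ φ in (-(π / 2))..(π / 2), ovalEnd h ^ (n + 2) / √2 * (Real.sin φ ^ n * Real.cos φ ^ 2 *
        √((√(1 + 4 * h) + 1) * Real.sin φ ^ 2 + (√(1 + 4 * h) - 1))) := by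
    have := intervalIntegral.integral_comp_mul_deriv (a := -(π / 2)) (b := π / 2)
      (f := fun φ => ovalEnd h * Real.sin φ) (f' := fun φ => ovalEnd h * Real.cos φ)
      (g := fun x => x ^ n * ovalArc h x)
      (fun φ _ => (Real.hasDerivAt_sin φ).const_mul _) (by fun_prop)
      (by unfold ovalArc; fun_prop)
    simp only [Real.sin_neg, Real.sin_pi_div_two, mul_neg, mul_one] at this
    rw [← this]
    refine intervalIntegral.integral_congr fun φ hφ => ?_
    rw [uIcc_of_le (by linarith [Real.pi_pos])] at hφ
    simp only [Function.comp_apply, ovalArc_sin hh hφ]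
    ring
  have hcos : cosInt n (rootParam h) = (∫ φ in (-(π / 2))..(π / 2), Real.sin φ ^ n *
      Real.cos φ ^ 2 * √((√(1 + 4 * h) + 1) * Real.sin φ ^ 2 + (√(1 + 4 * h) - 1)) : ℝ) := by
    rw [cosInt, rootParam_ofReal hh, ← intervalIntegral.integral_ofReal]
    refine intervalIntegral.integral_congr fun φ _ => ?_
    have : radicand (√(1 + 4 * h) : ℝ) φ =
        (((√(1 + 4 * h) + 1) * Real.sin φ ^ 2 + (√(1 + 4 * h) - 1) : ℝ) : ℂ) := by
      rw [radicand]
      push_cast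
      rfl
    simp only [this, sqrt_ofReal_of_nonneg (hr φ)]
    push_cast
    rfl
  rw [ovalIntegral_eq, hsub, intervalIntegral.integral_const_mul, ovalExt, hend, hcos]
  have h2 : (√2 : ℝ) * √2 = 2 := Real.mul_self_sqrt (by norm_num)
  have h20 : (√2 : ℝ) ≠ 0 := by positivity
  rw [← ofReal_pow, ← ofReal_mul, ← ofReal_mul]
  congr 1
  field_simp
  rw [pow_two, h2]
  ring

theorem isAbelianIntegral_ovalExt (n : ℕ) : IsAbelianIntegral n (ovalExt n) where
  analytic := analyticOnNhd_of_hasDerivAt isOpen_slitPlane fun _ => hasDerivAt_ovalExt n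
  eq_ovalIntegral _ := ovalExt_ofReal n

theorem _root_.IsAbelianIntegral.eqOn {n : ℕ} {I J : ℂ → ℂ} (hI : IsAbelianIntegral n I)
    (hJ : IsAbelianIntegral n J) : EqOn I J slitPlane := by
  refine hI.analytic.eqOn_of_preconnected_of_frequently_eq hJ.analytic
    (starConvex_one_slitPlane.isPathConnected one_mem_slitPlane).isConnected.isPreconnected one_mem_slitPlane ?_
  have ht : Filter.Tendsto (fun x : ℝ => (x : ℂ)) (𝓝[>] 1) (𝓝[≠] 1) := by
    refine tendsto_nhdsWithin_iff.2 ⟨?_, ?_⟩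
    · exact (continuous_ofReal.tendsto' 1 1 ofReal_one).mono_left nhdsWithin_le_nhds
    · filter_upwards [self_mem_nhdsWithin] with x hx
      simpa using (ne_of_gt hx)
  refine ht.frequently (Filter.Eventually.frequently ?_)
  filter_upwards [self_mem_nhdsWithin] with x hx
  have hx : 0 < x := one_pos.trans hx
  rw [hI.eq_ovalIntegral x hx, hJ.eq_ovalIntegral x hx]

/-! ### Linear relations and the Picard–Fuchs system for `I₀` and `I₂'`. -/

theorem deriv_ovalExt (n : ℕ) {h : ℂ} (hh : h ∈ slitPlane) :
    deriv (ovalExt n) h = 2 * √2 * sqrt (rootParam h + 1) ^ n * invInt n (rootParam h) :=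
  (hasDerivAt_ovalExt n hh).deriv

theorem deriv_ovalExt_two {h : ℂ} (hh : h ∈ slitPlane) :
    deriv (ovalExt 2) h = 2 * √2 * (rootParam h + 1) * invInt 2 (rootParam h) := by
  rw [deriv_ovalExt 2 hh, sqrt_sq_self]

theorem ovalExt_zero (h : ℂ) :
    ovalExt 0 h = √2 * (rootParam h + 1) * cosInt 0 (rootParam h) := by
  rw [ovalExt, zero_add, sqrt_sq_self]

/-- This is `∮ d(xy) = 0`, the recursion `invInt_rec` for `n = 0`. -/
theorem deriv_ovalExt_four {h : ℂ} (hh : h ∈ slitPlane) :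
    deriv (ovalExt 4) h = ovalExt 0 h + deriv (ovalExt 2) h := by
  have hs := rootParam_sub_one_mem hh
  have hrec := invInt_rec 0 hs
  rw [deriv_ovalExt_two hh, ovalExt_zero, deriv_ovalExt 4 hh, cosInt_eq 0 hs,
    show ∀ x : ℂ, x ^ 4 = (x ^ 2) ^ 2 from fun x => by ring, sqrt_sq_self]
  norm_num at hrec ⊢
  linear_combination (-√2 * (rootParam h + 1)) * hrec

/-- The recursions for `n = 0` and `n = 2`, that is `d(xy)` and `d(x³y)`, eliminate the higher
moments; `4h + 1 = s²`. -/
theorem deriv_ovalExt_two_relation {h : ℂ} (hh : h ∈ slitPlane) :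
    (4 * h + 1) * deriv (ovalExt 2) h = 5 * ovalExt 2 h - ovalExt 0 h := by
  have hs := rootParam_sub_one_mem hh
  have hrec := invInt_rec 0 hs
  have hrec2 := invInt_rec 2 hs
  have hsq := rootParam_sq h
  rw [deriv_ovalExt_two hh, ovalExt_zero, ovalExt, cosInt_eq 0 hs, cosInt_eq 2 hs,
    show ∀ x : ℂ, x ^ (2 + 2) = (x ^ 2) ^ 2 from fun x => by ring, sqrt_sq_self, add_comm (4 * h),
    ← hsq]
  norm_num at hrec hrec2 ⊢
  generalize rootParam h = s at *
  linear_combination (√2 * (s + 1)) * hrec - (√2 * (s + 1) ^ 2) * hrec2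

theorem hasDerivAt_ovalExt_zero {h : ℂ} (hh : h ∈ slitPlane) :
    HasDerivAt (ovalExt 0) ((3 * ovalExt 0 h - deriv (ovalExt 2) h) / (4 * h)) h := by
  refine (hasDerivAt_ovalExt 0 hh).congr_deriv ?_
  have hs := rootParam_sub_one_mem hh
  have hrec := invInt_rec 0 hs
  have hsq := rootParam_sq h
  have h0 := slitPlane_ne_zero hh
  rw [eq_div_iff (by simpa using h0), deriv_ovalExt_two hh, ovalExt_zero, cosInt_eq 0 hs,
    show 4 * h = rootParam h ^ 2 - 1 by rw [hsq]; ring]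
  norm_num at hrec ⊢
  generalize rootParam h = s at *
  linear_combination (-√2 * (s + 1)) * hrec

theorem four_mul_add_one_ne_zero {h : ℂ} (hh : h ∈ slitPlane) : 4 * h + 1 ≠ 0 := by
  rw [add_comm]
  exact slitPlane_ne_zero (one_add_mem hh)

theorem hasDerivAt_deriv_ovalExt_two {h : ℂ} (hh : h ∈ slitPlane) :
    HasDerivAt (deriv (ovalExt 2))
      (((4 * h + 1) * deriv (ovalExt 2) h - 3 * ovalExt 0 h) / (4 * h * (4 * h + 1))) h := by
  have h0 := slitPlane_ne_zero hh
  have h1 := four_mul_add_one_ne_zero hh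
  -- Solving the relation for `I₂'` gives its derivative from first derivatives only.
  have heq : deriv (ovalExt 2) =ᶠ[𝓝 h] fun z => (5 * ovalExt 2 z - ovalExt 0 z) / (4 * z + 1) := by
    filter_upwards [isOpen_slitPlane.mem_nhds hh] with z hz
    rw [← deriv_ovalExt_two_relation hz, mul_div_cancel_left₀ _ (four_mul_add_one_ne_zero hz)]
  have h2 : HasDerivAt (ovalExt 2) (deriv (ovalExt 2) h) h :=
    (hasDerivAt_ovalExt 2 hh).differentiableAt.hasDerivAt
  have h3 : HasDerivAt (fun z : ℂ => 4 * z + 1) 4 h :=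
    (((hasDerivAt_id h).const_mul 4).add_const 1).congr_deriv (by ring)
  refine ((((h2.const_mul 5).sub (hasDerivAt_ovalExt_zero hh)).div h3 h1).congr_of_eventuallyEq
    heq).congr_deriv ?_
  simp only [Pi.sub_apply, ← deriv_ovalExt_two_relation hh]
  field_simp
  ring

theorem deriv_ovalExt_two_ne_zero {h : ℂ} (hh : h ∈ slitPlane) : deriv (ovalExt 2) h ≠ 0 := by
  rw [deriv_ovalExt_two hh]
  have h1 := slitPlane_ne_zero (rootParam_add_one_mem hh)
  have h2 : invInt 2 (rootParam h) ≠ 0 := fun h0 => by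
    have := invInt_re_pos even_two (rootParam_sub_one_mem hh)
    simp [h0] at this
  have h3 : (√2 : ℂ) ≠ 0 := by simp
  exact mul_ne_zero (mul_ne_zero (mul_ne_zero two_ne_zero h3) h1) h2

/-! ### The quotient `P = I₀ / I₂'` and its Riccati equation. -/

/-- The quotient of `I₀` and `I₂'`. -/
noncomputable def quot (h : ℂ) : ℂ := ovalExt 0 h / deriv (ovalExt 2) h

theorem quot_eq {h : ℂ} (hh : h ∈ slitPlane) :
    quot h = cosInt 0 (rootParam h) / (2 * invInt 2 (rootParam h)) := by
  have h0 := deriv_ovalExt_two_ne_zero hh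
  rw [quot]
  rw [deriv_ovalExt_two hh] at h0 ⊢
  have h1 := left_ne_zero_of_mul h0
  have h2 := right_ne_zero_of_mul h0
  have h3 := right_ne_zero_of_mul h1
  have h4 := right_ne_zero_of_mul (left_ne_zero_of_mul h1)
  rw [ovalExt_zero]
  field_simp

theorem hasDerivAt_quot {h : ℂ} (hh : h ∈ slitPlane) :
    HasDerivAt quot ((3 * quot h ^ 2 + (4 * h + 1) * (2 * quot h - 1)) / (4 * h * (4 * h + 1))) h := by
  have h0 := deriv_ovalExt_two_ne_zero hh
  have h1 := slitPlane_ne_zero hh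
  have h2 := four_mul_add_one_ne_zero hh
  refine ((hasDerivAt_ovalExt_zero hh).div (hasDerivAt_deriv_ovalExt_two hh) h0).congr_deriv ?_
  rw [quot]
  field_simp
  ring

theorem quot_analytic : AnalyticOnNhd ℂ quot slitPlane :=
  analyticOnNhd_of_hasDerivAt isOpen_slitPlane fun _ => hasDerivAt_quot

/-- `cosInt 0` lies in the open first quadrant and `invInt 2` in the open fourth, so their quotient
has argument in `(0, π)`. -/
theorem quot_im_pos {h : ℂ} (hh : 0 < h.im) : 0 < (quot h).im := by
  have hm : h ∈ slitPlane := Or.inr hh.ne'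
  have hs := rootParam_sub_one_mem hm
  have him := rootParam_im_pos hh
  have h1 := cosInt_zero_re_pos hs
  have h2 := cosInt_zero_im_pos him
  have h3 := invInt_re_pos even_two hs
  have h4 := invInt_im_neg even_two him
  have h5 : 0 < normSq (2 * invInt 2 (rootParam h)) := normSq_pos.2 fun h0 => by
    have := congrArg re h0
    simp at this
    linarith
  rw [quot_eq hm, div_im, ← sub_div]
  apply div_pos _ h5
  simp only [mul_re, mul_im, re_ofNat, im_ofNat, zero_mul, sub_zero, add_zero]
  nlinarith [mul_pos h2 h3, mul_pos h1 (neg_pos.2 h4)]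

theorem quot_conj {h : ℂ} (hh : h ∈ slitPlane) :
    quot (conj h) = conj (quot h) := by
  have hh' : conj h ∈ slitPlane := by
    simpa [mem_slitPlane_iff] using hh
  have hs : rootParam (conj h) = conj (rootParam h) := by
    rw [rootParam, rootParam, ← sqrt_conj (one_add_mem hh)]
    simp only [map_add, map_mul, map_one, map_ofNat]
  have h1 := rootParam_sub_one_mem hh
  rw [quot_eq hh', quot_eq hh, hs, cosInt_conj 0 h1, invInt_conj 2 h1]
  simp only [map_div₀, map_mul, map_ofNat]

theorem quot_im_neg {h : ℂ} (hh : h.im < 0) : (quot h).im < 0 := by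
  have := quot_im_pos (h := conj h) (by simpa using hh)
  rw [quot_conj (Or.inr hh.ne)] at this
  simpa using this

theorem ofReal_mem {x : ℝ} (hx : 0 < x) : (x : ℂ) ∈ slitPlane := Or.inl (by simpa using hx)

theorem quot_ofReal {x : ℝ} (hx : 0 < x) : ((quot x).re : ℂ) = quot x :=
  conj_eq_iff_re.1 (by rw [← quot_conj (ofReal_mem hx), conj_ofReal])

theorem hasDerivAt_quot_re {x : ℝ} (hx : 0 < x) :
    HasDerivAt (fun x : ℝ => (quot x).re)
      ((3 * (quot x).re ^ 2 + (4 * x + 1) * (2 * (quot x).re - 1)) / (4 * x * (4 * x + 1))) x := by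
  have h1 := hasDerivAt_quot (ofReal_mem hx)
  rw [← quot_ofReal hx] at h1
  refine h1.real_of_complex.congr_deriv ?_
  exact_mod_cast ofReal_re _

theorem quot_re_bounds {x : ℝ} (hx : 0 < x) :
    0 < (quot x).re ∧ (quot x).re ≤ √(1 + 4 * x) := by
  have hm := ofReal_mem hx
  have hs := rootParam_sub_one_mem hm
  have h1 := cosInt_zero_re_pos hs
  have h3 := invInt_re_pos even_two hs
  have hle := cosInt_zero_le (one_lt_sqrt hx)
  rw [← rootParam_ofReal hx] at hle
  have hreal : conj (rootParam x) = rootParam x := by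
    rw [rootParam_ofReal hx, conj_ofReal]
  have hK := conj_eq_iff_re.1 (by rw [← cosInt_conj 0 hs, hreal] :
    conj (cosInt 0 (rootParam x)) = _)
  have hL := conj_eq_iff_re.1 (by rw [← invInt_conj 2 hs, hreal] :
    conj (invInt 2 (rootParam x)) = _)
  have hq : (quot x).re = (cosInt 0 (rootParam x)).re / (2 * (invInt 2 (rootParam x)).re) := by
    rw [quot_eq hm, ← hK, ← hL]
    exact_mod_cast ofReal_re _
  rw [hq, div_le_iff₀ (by positivity)]
  exact ⟨by positivity, by linarith⟩

/-- At a positive point the derivative of `quot` is real, so it equals the vertical derivative of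
`Im quot`, which is zero on the axis and positive above it. -/
theorem quot_deriv_nonneg {x : ℝ} (hx : 0 < x) :
    0 ≤ (3 * (quot x).re ^ 2 + (4 * x + 1) * (2 * (quot x).re - 1)) / (4 * x * (4 * x + 1)) := by
  set q := (3 * (quot x).re ^ 2 + (4 * x + 1) * (2 * (quot x).re - 1)) / (4 * x * (4 * x + 1))
    with hq
  have h1 : HasDerivAt quot (q : ℂ) x := by
    refine (hasDerivAt_quot (ofReal_mem hx)).congr_deriv ?_
    rw [← quot_ofReal hx, hq]
    push_cast
    rfl
  have hline : HasDerivAt (fun t : ℝ => (x : ℂ) + t * I) I 0 :=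
    ((ofRealCLM.hasDerivAt.mul_const I).const_add (x : ℂ)).congr_deriv (by simp)
  have h2 : HasDerivAt (fun t : ℝ => quot ((x : ℂ) + t * I)) (q * I) 0 :=
    HasDerivAt.comp (h₂ := quot) 0 (by simpa using h1) hline
  have h3 : HasDerivAt (fun t : ℝ => (quot ((x : ℂ) + t * I)).im) q 0 :=
    (imCLM.hasFDerivAt.comp_hasDerivAt 0 h2).congr_deriv (by simp)
  refine ge_of_tendsto h3.tendsto_slope_zero_right ?_
  filter_upwards [self_mem_nhdsWithin] with t ht
  have ht : 0 < t := ht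
  have hx0 : (quot x).im = 0 := by rw [← quot_ofReal hx, ofReal_im]
  have := quot_im_pos (h := x + t * I) (by simpa using ht)
  simp only [zero_add, ofReal_zero, zero_mul, add_zero, hx0, sub_zero, smul_eq_mul]
  positivity

/-! ### Strict concavity on the positive axis. -/

theorem hasDerivAt_deriv_ovalExt_two_re {x : ℝ} (hx : 0 < x) :
    HasDerivAt (fun x : ℝ => (deriv (ovalExt 2) x).re)
      ((deriv (ovalExt 2) x).re * ((4 * x + 1 - 3 * (quot x).re) / (4 * x * (4 * x + 1)))) x := by
  have h0 := deriv_ovalExt_two_ne_zero (ofReal_mem hx)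
  have h1 := (hasDerivAt_deriv_ovalExt_two (ofReal_mem hx)).real_of_complex
  refine h1.congr_deriv ?_
  have : ovalExt 0 x = deriv (ovalExt 2) x * ((quot x).re : ℝ) := by
    rw [quot_ofReal hx, quot, mul_div_cancel₀ _ h0]
  rw [this, ← re_mul_ofReal]
  congr 1
  push_cast
  ring

/-- A positive solution of the Riccati equation of `I₀ / I₂'` that grows slower than linearly has a
derivative `q` with negative derivative. The function `g` only serves to build an integrating factor. -/
theorem riccati_concave {p g q : ℝ → ℝ}
    (hq : ∀ x, q x = (3 * p x ^ 2 + (4 * x + 1) * (2 * p x - 1)) / (4 * x * (4 * x + 1)))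
    (hp : ∀ x, 0 < x → HasDerivAt p (q x) x)
    (hg : ∀ x, 0 < x → HasDerivAt g (g x * ((4 * x + 1 - 3 * p x) / (4 * x * (4 * x + 1)))) x)
    (hg0 : ∀ x, 0 < x → g x ≠ 0) (hp0 : ∀ x, 0 < x → 0 < p x)
    (hp1 : ∀ x, 0 < x → p x ≤ √(1 + 4 * x)) (hq0 : ∀ x, 0 < x → 0 ≤ q x) :
    ∀ x, 0 < x → ∃ q' < 0, HasDerivAt q q' x := by
  have hN : ∀ x, 0 < x → q x * (4 * x * (4 * x + 1)) =
      3 * p x ^ 2 + (4 * x + 1) * (2 * p x - 1) := fun x hx => by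
    rw [hq]
    field_simp
  -- `V = 4x(4x + 1) q'`, by differentiating the Riccati equation; the goal becomes `V < 0`.
  set V : ℝ → ℝ := fun x => q x * (6 * p x - 24 * x - 2) + 8 * p x - 4 with hV
  have hlin : ∀ (a b x : ℝ), HasDerivAt (fun x : ℝ => a * x + b) a x := fun a b x =>
    (((hasDerivAt_id x).const_mul a).add_const b).congr_deriv (by ring)
  have hq' : ∀ x, 0 < x → HasDerivAt q (V x / (4 * x * (4 * x + 1))) x := fun x hx => by
    rw [show q = fun x => (3 * p x ^ 2 + (4 * x + 1) * (2 * p x - 1)) / (4 * x * (4 * x + 1)) from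
      funext hq]
    have h1 := ((((hp x hx).pow 2).const_mul 3).add ((hlin 4 1 x).mul
      (((hp x hx).const_mul 2).sub_const 1))).div
      ((((hasDerivAt_id x).const_mul 4)).mul (hlin 4 1 x)) (by simp; constructor <;> linarith)
    refine h1.congr_deriv ?_
    have h2 := hN x hx
    simp only [hV, Pi.add_apply, Pi.mul_apply, Pi.pow_apply, id]
    rw [← h2]
    field_simp
    ring
  have hV' : ∀ x, 0 < x → HasDerivAt V
      (V x / (4 * x * (4 * x + 1)) * (6 * p x - 24 * x - 2) + q x * (6 * q x - 16)) x :=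
    fun x hx => by
    refine ((((hq' x hx).mul ((((hp x hx).const_mul 6).sub
      ((hasDerivAt_id x).const_mul 24)).sub_const 2)).add
      ((hp x hx).const_mul 8)).sub_const 4).congr_deriv ?_
    simp only [Pi.sub_apply, id]
    ring
  -- A zero of `q ≥ 0` is a minimum, so `V = 0` and `p = 1/2`; the Riccati equation would then read
  -- `3/4 = 0`.
  have hq1 : ∀ x, 0 < x → 0 < q x := fun x hx => by
    refine (hq0 x hx).lt_of_ne fun h0 => ?_
    have hmin : IsLocalMin q x := by
      filter_upwards [lt_mem_nhds hx] with y hy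
      rw [← h0]
      exact hq0 y hy
    have h1 := hmin.hasDerivAt_eq_zero (hq' x hx)
    have h2 := hN x hx
    have h3 := hp0 x hx
    have hVx : V x = 0 := by
      rcases div_eq_zero_iff.1 h1 with h | h
      · exact h
      · exact absurd h (by positivity)
    simp only [hV, ← h0, zero_mul, zero_add] at hVx h2
    nlinarith
  have hstat : ∀ x, 0 < x → 0 ≤ V x → q x ≤ 8 / 3 → 1 / 24 ≤ x ∧ q x < 8 / 3 := fun x hx h1 h2 => by
    have h3 := hN x hx
    have h4 := hq1 x hx
    have h5 := hp0 x hx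
    -- For `q = 8/3` the condition `V ≥ 0` is exactly this inequality. On the line itself the
    -- Riccati numerator exceeds `(8/3) · 4x(4x + 1)` by `25/108`.
    have key : (8 / 3) * x + 7 / 18 ≤ p x → False := fun h6 => by
      have h7 : q x * (4 * x * (4 * x + 1)) ≤ 8 / 3 * (4 * x * (4 * x + 1)) :=
        mul_le_mul_of_nonneg_right h2 (by positivity)
      nlinarith
    simp only [hV] at h1
    rcases lt_or_ge 0 (6 * p x - 24 * x - 2) with h6 | h6
    · exact (key (by nlinarith)).elim
    · refine ⟨by nlinarith, h2.lt_of_ne fun h7 => key ?_⟩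
      rw [h7] at h1
      linarith
  -- Since `q (6 q - 16) = 6 q (q - 8/3)`, the function `q - 8/3` solves a linear second order
  -- equation with positive potential `6 q`. The weight `g² (4x + 1)` cancels its first order term,
  -- so `Φ` is increasing.
  set Φ : ℝ → ℝ := fun x => g x ^ 2 * (4 * x + 1) * ((q x - 8 / 3) * V x) with hΦ
  have hΦ' : ∀ x, 0 < x → HasDerivAt Φ (g x ^ 2 * (4 * x + 1) *
      (V x ^ 2 / (4 * x * (4 * x + 1)) + 6 * q x * (q x - 8 / 3) ^ 2)) x := fun x hx => by
    refine ((((hg x hx).pow 2).mul (hlin 4 1 x)).mul (((hq' x hx).sub_const (8 / 3)).mul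
      (hV' x hx))).congr_deriv ?_
    simp only [Pi.mul_apply, Pi.pow_apply]
    field_simp
    ring
  have hmono : StrictMonoOn Φ (Ioi 0) := by
    refine strictMonoOn_of_deriv_pos (convex_Ioi 0)
      (fun x hx => (hΦ' x hx).continuousAt.continuousWithinAt) fun x hx => ?_
    rw [interior_Ioi] at hx
    have hx : 0 < x := hx
    rw [(hΦ' x hx).deriv]
    have h1 := hq1 x hx
    have h2 := sq_pos_of_ne_zero (hg0 x hx)
    refine mul_pos (by positivity) ?_
    rcases eq_or_ne (V x) 0 with h3 | h3
    · have : q x - 8 / 3 ≠ 0 := fun h4 =>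
        (hstat x hx h3.ge (by linarith)).2.ne (by linarith)
      have := sq_pos_of_ne_zero this
      positivity
    · have := sq_pos_of_ne_zero h3
      positivity
  have hqc : ContinuousOn q (Ioi 0) := fun x hx => (hq' x hx).continuousAt.continuousWithinAt
  have hVneg : ∀ c, 0 < c → V c < 0 := fun c hc => by
    by_contra! hVc
    rcases le_or_gt (q c) (8 / 3) with h1 | h1
    · obtain ⟨-, h1⟩ := hstat c hc hVc h1
      -- Now `Φ < 0` on `(0, c)`, so `q` cannot cross `8/3` there and `V` stays positive down to
      -- `0`. This contradicts `hstat` at a point below `1/24`.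
      have hΦc : Φ c ≤ 0 := mul_nonpos_of_nonneg_of_nonpos (by positivity)
        (mul_nonpos_of_nonpos_of_nonneg (by linarith) hVc)
      set x := min c (1 / 24) / 2 with hxdef
      have hm : 0 < min c (1 / 24) := lt_min hc (by norm_num)
      have hx : 0 < x := by positivity
      have hxc : x < c := by have := min_le_left c (1 / 24); linarith
      have hneg : ∀ y, 0 < y → y < c → Φ y < 0 := fun y hy hyc =>
        (hmono hy hc hyc).trans_le hΦc
      have hqx : q x < 8 / 3 := by
        by_contra! h2
        obtain ⟨y, hy, hy2⟩ := intermediate_value_Icc' hxc.le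
          (hqc.mono fun z hz => hx.trans_le hz.1) ⟨h1.le, h2⟩
        have hyc : y < c := hy.2.lt_of_ne fun h => by rw [h] at hy2; exact h1.ne hy2
        have := hneg y (hx.trans_le hy.1) hyc
        simp [hΦ, hy2] at this
      have hVx : 0 ≤ V x := by
        by_contra! h2
        have h3 := hneg x hx hxc
        have h4 : 0 ≤ Φ x := mul_nonneg (by positivity)
          (mul_nonneg_of_nonpos_of_nonpos (by linarith) h2.le)
        linarith
      have := (hstat x hx hVx hqx.le).1
      have := min_le_right c (1 / 24)
      linarith
    -- Now `Φ > 0` beyond `c`, so `p` grows with slope above `8/3`. On `[c, 1 + 2c]`, of length `1 +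
    -- c`, this already breaks the bound `√(1 + 4x)`.
    · have hΦc : 0 ≤ Φ c := mul_nonneg (by positivity) (mul_nonneg (by linarith) hVc)
      have hqx : ∀ x, c < x → 8 / 3 < q x := fun x hx => by
        by_contra! h2
        obtain ⟨y, hy, hy2⟩ := intermediate_value_Icc' hx.le
          (hqc.mono fun z hz => hc.trans_le hz.1) ⟨h2, h1.le⟩
        have hyc : c < y := hy.1.lt_of_ne fun h => by rw [← h] at hy2; exact h1.ne' hy2
        have := hΦc.trans_lt (hmono hc (hc.trans hyc) hyc)
        simp [hΦ, hy2] at this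
      have hc2 : c < 1 + 2 * c := by linarith
      obtain ⟨ξ, hξ, hξ2⟩ := exists_hasDerivAt_eq_slope p q hc2
        (fun z hz => (hp z (hc.trans_le hz.1)).continuousAt.continuousWithinAt)
        (fun z hz => hp z (hc.trans hz.1))
      have h2 := hqx ξ hξ.1
      rw [hξ2, lt_div_iff₀ (by linarith)] at h2
      have h3 := hp0 c hc
      have h4 := hp1 (1 + 2 * c) (by linarith)
      have h5 : √(1 + 4 * (1 + 2 * c)) < 8 / 3 * (1 + c) := by
        rw [Real.sqrt_lt' (by positivity)]
        nlinarith
      linarith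
  exact fun x hx => ⟨_, div_neg_of_neg_of_pos (hVneg x hx) (by positivity), hq' x hx⟩

/-! ### Schwarz–Pick in the upper half plane. -/

theorem norm_cayley_lt_one {z w : ℂ} (hz : 0 < z.im) (hw : 0 < w.im) :
    ‖(w - z) / (w - conj z)‖ < 1 := by
  have h0 : w - conj z ≠ 0 := fun h => by
    have := congrArg im h
    simp at this
    linarith
  rw [norm_div, div_lt_one (norm_pos_iff.2 h0)]
  refine lt_of_pow_lt_pow_left₀ 2 (norm_nonneg _) ?_
  rw [← normSq_eq_norm_sq, ← normSq_eq_norm_sq, normSq_apply, normSq_apply]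
  simp
  nlinarith [mul_pos hz hw]

theorem im_inv_cayley_pos {z u : ℂ} (hz : 0 < z.im) (hu : ‖u‖ < 1) :
    0 < ((z - u * conj z) / (1 - u)).im := by
  have h0 : 1 - u ≠ 0 := fun h => by
    rw [← sub_eq_zero.1 h] at hu
    simp at hu
  have h1 : normSq u < 1 := by
    rw [normSq_eq_norm_sq]
    nlinarith [norm_nonneg u]
  rw [normSq_apply] at h1
  rw [div_im, ← sub_div]
  refine div_pos ?_ (normSq_pos.2 h0)
  simp
  nlinarith

/-- **Schwarz–Pick**: a holomorphic self-map of the upper half plane with two fixed points, or with a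
fixed point of multiplier one, is the identity. -/
theorem eq_self_of_fixedPoint {f : ℂ → ℂ} (hf : DifferentiableOn ℂ f {z | 0 < z.im})
    (hm : ∀ z : ℂ, 0 < z.im → 0 < (f z).im) {z : ℂ} (hz : 0 < z.im) (hfz : f z = z)
    (h : (∃ w : ℂ, 0 < w.im ∧ w ≠ z ∧ f w = w) ∨ deriv f z = 1) {w : ℂ} (hw : 0 < w.im) :
    f w = w := by
  set C : ℂ → ℂ := fun w => (w - z) / (w - conj z) with hC
  set B : ℂ → ℂ := fun u => (z - u * conj z) / (1 - u) with hB
  have hzz : z - conj z ≠ 0 := fun h => by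
    have := congrArg im h
    simp at this
    linarith
  have hC0 : ∀ w : ℂ, 0 < w.im → w - conj z ≠ 0 := fun w hw h => by
    have := congrArg im h
    simp at this
    linarith
  have hB0 : ∀ u : ℂ, ‖u‖ < 1 → 1 - u ≠ 0 := fun u hu h => by
    rw [← sub_eq_zero.1 h] at hu
    simp at hu
  have hBC : ∀ w : ℂ, 0 < w.im → B (C w) = w := fun w hw => by
    have h1 := hC0 w hw
    have h2 : 1 - C w = (z - conj z) / (w - conj z) := by
      simp only [hC]
      field_simp
      ring
    simp only [hB, h2]
    simp only [hC]
    field_simp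
    ring
  have hBd : ∀ u : ℂ, ‖u‖ < 1 → HasDerivAt B ((z - conj z) / (1 - u) ^ 2) u := fun u hu => by
    refine ((((hasDerivAt_id u).mul_const (conj z)).const_sub z).div
      ((hasDerivAt_id u).const_sub 1) (hB0 u hu)).congr_deriv ?_
    simp only [id]
    ring
  have hCd : ∀ w : ℂ, 0 < w.im → HasDerivAt C ((z - conj z) / (w - conj z) ^ 2) w := fun w hw => by
    refine (((hasDerivAt_id w).sub_const z).div
      ((hasDerivAt_id w).sub_const (conj z)) (hC0 w hw)).congr_deriv ?_
    simp only [id]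
    ring
  have hopen : IsOpen {z : ℂ | 0 < z.im} := isOpen_lt continuous_const continuous_im
  set ψ : ℂ → ℂ := C ∘ f ∘ B with hψ
  have hψd : ∀ u : ℂ, ‖u‖ < 1 → HasDerivAt ψ ((z - conj z) / (f (B u) - conj z) ^ 2 *
      (deriv f (B u) * ((z - conj z) / (1 - u) ^ 2))) u := fun u hu => by
    have h1 : 0 < (B u).im := im_inv_cayley_pos hz hu
    have h2 := (hf.differentiableAt (hopen.mem_nhds h1)).hasDerivAt
    exact (hCd _ (hm _ h1)).comp u (h2.comp u (hBd u hu))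
  have hB00 : B 0 = z := by simp [hB]
  have hψ0 : ψ 0 = 0 := by simp [hψ, hB00, hfz, hC]
  have hd : DifferentiableOn ℂ ψ (Metric.ball 0 1) := fun u hu =>
    (hψd u (by simpa using hu)).differentiableAt.differentiableWithinAt
  have hmaps : MapsTo ψ (Metric.ball 0 1) (Metric.closedBall (ψ 0) 1) := fun u hu => by
    rw [hψ0, mem_closedBall_zero_iff]
    exact (norm_cayley_lt_one hz (hm _ (im_inv_cayley_pos hz (by simpa using hu)))).le
  -- A second fixed point gives `ψ u / u = 1`, multiplier one gives `ψ' 0 = 1`. Either is the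
  -- equality case of the Schwarz lemma, so `ψ` is the identity of the disc.
  have hsl : ∃ u ∈ Metric.ball (0 : ℂ) 1, dslope ψ 0 u = 1 := by
    rcases h with ⟨w, hw, hwz, hfw⟩ | h
    · have hCw : C w ≠ 0 := div_ne_zero (sub_ne_zero.2 hwz) (hC0 w hw)
      refine ⟨C w, mem_ball_zero_iff.2 (norm_cayley_lt_one hz hw), ?_⟩
      rw [dslope_of_ne _ hCw, slope_def_field, hψ0]
      simp only [hψ, Function.comp_apply, hBC w hw, hfw, sub_zero]
      exact div_self hCw
    · refine ⟨0, by simp, ?_⟩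
      rw [dslope_same, (hψd 0 (by simp)).deriv, hB00, hfz, h]
      field_simp
      simp
  obtain ⟨u, hu, hu1⟩ := hsl
  have haff := affine_of_mapsTo_ball_of_norm_dslope_eq_div hd hmaps hu (by simp [hu1])
  have h1 := haff (mem_ball_zero_iff.2 (norm_cayley_lt_one hz hw))
  have h2 : ψ (C w) = C (f w) := by simp only [hψ, Function.comp_apply, hBC w hw]
  rw [← show C w = (w - z) / (w - conj z) from rfl, h2] at h1
  simp only [hψ0, hu1, smul_eq_mul, sub_zero, mul_one, zero_add] at h1
  rw [← hBC (f w) (hm w hw), h1, hBC w hw]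

/-- A holomorphic self-map of the upper half plane that is not affine agrees with a real affine
function at one point at most, and there to first order. -/
theorem affine_intersection {P : ℂ → ℂ} (hP : DifferentiableOn ℂ P {z | 0 < z.im})
    (hm : ∀ z : ℂ, 0 < z.im → 0 < (P z).im) {a b : ℝ}
    (hne : ∃ z : ℂ, 0 < z.im ∧ P z ≠ a + b * z) {z : ℂ} (hz : 0 < z.im) (hPz : P z = a + b * z) :
    deriv P z ≠ b ∧ ∀ w : ℂ, 0 < w.im → P w = a + b * w → w = z := by
  have hb : 0 < b := by
    have h1 := hm z hz
    rw [hPz] at h1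
    simp at h1
    exact pos_of_mul_pos_left h1 hz.le
  have hb0 : (b : ℂ) ≠ 0 := by exact_mod_cast hb.ne'
  have hopen : IsOpen {z : ℂ | 0 < z.im} := isOpen_lt continuous_const continuous_im
  have hiff : ∀ w : ℂ, (P w - a) / b = w ↔ P w = a + b * w := fun w => by
    rw [div_eq_iff hb0, sub_eq_iff_eq_add, add_comm, mul_comm]
  have hfm : ∀ w : ℂ, 0 < w.im → 0 < ((P w - a) / b).im := fun w hw => by
    rw [div_ofReal_im]
    simpa using div_pos (hm w hw) hb
  have key : ((∃ w : ℂ, 0 < w.im ∧ w ≠ z ∧ (P w - a) / b = w) ∨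
      deriv (fun w => (P w - a) / b) z = 1) → False := fun h => by
    obtain ⟨w, hw, hPw⟩ := hne
    exact hPw ((hiff w).1 (eq_self_of_fixedPoint (f := fun w => (P w - a) / b)
      ((hP.sub_const _).div_const _) hfm hz ((hiff z).2 hPz) h hw))
  refine ⟨fun h => key (Or.inr ?_), fun w hw hPw => ?_⟩
  · have h1 := (hP.differentiableAt (hopen.mem_nhds hz)).hasDerivAt
    rw [((h1.sub_const _).div_const _).deriv, h, div_self hb0]
  · by_contra hwz
    exact key (Or.inl ⟨w, hw, hwz, (hiff w).2 hPw⟩)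

/-! ### Bounds for orders of zeros and their sums. -/

theorem sum_le_one_of_subsingleton {ι : Type*} [DecidableEq ι] {S : Finset ι} {o : ι → ℕ∞}
    (h1 : ∀ z ∈ S, o z ≤ 1) (h2 : ∀ z ∈ S, ∀ w ∈ S, o z ≠ 0 → o w ≠ 0 → z = w) :
    ∑ z ∈ S, o z ≤ 1 := by
  rw [← Finset.sum_filter_ne_zero]
  have hc : (S.filter fun z => o z ≠ 0).card ≤ 1 := by
    refine Finset.card_le_one.2 fun z hz w hw => ?_
    rw [Finset.mem_filter] at hz hw
    exact h2 z hz.1 w hw.1 hz.2 hw.2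
  calc _ ≤ (S.filter fun z => o z ≠ 0).card • (1 : ℕ∞) :=
        Finset.sum_le_card_nsmul _ _ _ fun z hz => h1 z (Finset.mem_of_mem_filter z hz)
    _ ≤ 1 := by simpa using hc

theorem sum_le_two {ι : Type*} [DecidableEq ι] {S : Finset ι} {o : ι → ℕ∞}
    (h1 : ∀ z ∈ S, o z ≤ 2) (h2 : ∀ z ∈ S, ∀ w ∈ S, z ≠ w → o z ≠ 0 → o w ≠ 0 → o z ≤ 1)
    (h3 : ∀ x ∈ S, ∀ y ∈ S, ∀ z ∈ S, x ≠ y → x ≠ z → y ≠ z → o x ≠ 0 → o y ≠ 0 → o z ≠ 0 → False) :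
    ∑ z ∈ S, o z ≤ 2 := by
  rw [← Finset.sum_filter_ne_zero]
  set T := S.filter fun z => o z ≠ 0 with hT
  have hc : T.card ≤ 2 := by
    by_contra! h
    obtain ⟨x, y, z, hx, hy, hz, hxy, hxz, hyz⟩ := Finset.two_lt_card_iff.1 h
    rw [hT, Finset.mem_filter] at hx hy hz
    exact h3 x hx.1 y hy.1 z hz.1 hxy hxz hyz hx.2 hy.2 hz.2
  rcases le_or_gt T.card 1 with h | h
  · calc _ ≤ T.card • (2 : ℕ∞) :=
          Finset.sum_le_card_nsmul _ _ _ fun z hz => h1 z (Finset.mem_of_mem_filter z hz)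
      _ ≤ 1 • (2 : ℕ∞) := nsmul_le_nsmul_left zero_le h
      _ = 2 := one_nsmul _
  · calc _ ≤ T.card • (1 : ℕ∞) := Finset.sum_le_card_nsmul _ _ _ fun z hz => by
          obtain ⟨w, hw, hwz⟩ := Finset.exists_mem_ne h z
          rw [hT, Finset.mem_filter] at hz hw
          exact h2 z hz.1 w hw.1 hwz.symm hz.2 hw.2
      _ ≤ 2 := by simpa using mod_cast hc

theorem analyticOrderAt_le_one {f : ℂ → ℂ} {z : ℂ} (hf : AnalyticAt ℂ f z)
    (h : f z = 0 → deriv f z ≠ 0) : analyticOrderAt f z ≤ 1 := by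
  by_cases h0 : f z = 0
  · exact (hf.analyticOrderAt_eq_one_of_zero_deriv_ne_zero h0 (h h0)).le
  · rw [hf.analyticOrderAt_eq_zero.2 h0]
    exact zero_le

theorem analyticOrderAt_le_two {f : ℂ → ℂ} {z : ℂ} (hf : AnalyticAt ℂ f z)
    (h : deriv (deriv f) z ≠ 0) : analyticOrderAt f z ≤ 2 := by
  by_cases h0 : f z = 0
  · have h1 := hf.analyticOrderAt_deriv_add_one
    simp only [h0, sub_zero] at h1
    rw [← h1]
    calc _ ≤ (1 : ℕ∞) + 1 := by
          gcongr
          exact analyticOrderAt_le_one hf.deriv fun _ => h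
      _ = 2 := one_add_one_eq_two
  · rw [hf.analyticOrderAt_eq_zero.2 h0]
    exact zero_le

/-- The derivative of `quot` on the positive real axis. -/
noncomputable def quotSlope (x : ℝ) : ℝ :=
  (3 * (quot x).re ^ 2 + (4 * x + 1) * (2 * (quot x).re - 1)) / (4 * x * (4 * x + 1))

theorem quotSlope_hasDerivAt_neg {x : ℝ} (hx : 0 < x) : ∃ q' < 0, HasDerivAt quotSlope q' x := by
  refine riccati_concave (p := fun x => (quot x).re) (g := fun x => (deriv (ovalExt 2) x).re)
    (fun _ => rfl) (fun _ => hasDerivAt_quot_re) (fun _ => hasDerivAt_deriv_ovalExt_two_re)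
    (fun x hx h => ?_) (fun _ hx => (quot_re_bounds hx).1) (fun _ hx => (quot_re_bounds hx).2)
    (fun _ => quot_deriv_nonneg) x hx
  have h1 : deriv (ovalExt 2) x = (2 * √2 * (√(1 + 4 * x) + 1) : ℝ) *
      invInt 2 (rootParam x) := by
    rw [deriv_ovalExt_two (ofReal_mem hx), rootParam_ofReal hx]
    push_cast
    rfl
  have h2 := invInt_re_pos even_two (rootParam_sub_one_mem (ofReal_mem hx))
  rw [h1, re_ofReal_mul] at h
  have : 0 < 2 * √2 * (√(1 + 4 * x) + 1) * (invInt 2 (rootParam x)).re := by positivity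
  exact this.ne' h

theorem quotSlope_strictAntiOn : StrictAntiOn quotSlope (Ioi 0) := by
  refine strictAntiOn_of_deriv_neg (convex_Ioi 0) (fun x hx => ?_) fun x hx => ?_
  · obtain ⟨_, -, h⟩ := quotSlope_hasDerivAt_neg hx
    exact h.continuousAt.continuousWithinAt
  · rw [interior_Ioi] at hx
    obtain ⟨_, h0, h⟩ := quotSlope_hasDerivAt_neg hx
    rwa [h.deriv]

theorem deriv_quot_ofReal {x : ℝ} (hx : 0 < x) : deriv quot x = quotSlope x := by
  rw [(hasDerivAt_quot (ofReal_mem hx)).deriv, quotSlope, ← quot_ofReal hx]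
  push_cast
  rfl

/-- Two derivatives remove an affine term, so this bounds the order of every real intersection by
two. -/
theorem deriv_deriv_quot_ne_zero {x : ℝ} (hx : 0 < x) : deriv (deriv quot) x ≠ 0 := by
  intro h
  obtain ⟨q', hq', hd⟩ := quotSlope_hasDerivAt_neg hx
  have h1 := (quot_analytic x (ofReal_mem hx)).deriv.differentiableAt.hasDerivAt.real_of_complex
  have h2 : (fun x : ℝ => (deriv quot x).re) =ᶠ[𝓝 x] quotSlope := by
    filter_upwards [lt_mem_nhds hx] with y hy
    rw [deriv_quot_ofReal hy, ofReal_re]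
  have h3 := (h1.congr_of_eventuallyEq h2.symm).unique hd
  rw [h, zero_re] at h3
  exact hq'.ne h3.symm

/-! ### Intersections of `quot` with a real affine function. -/

section Affine

variable (a b : ℝ)

theorem quot_sub_affine_analyticAt {z : ℂ} (hz : z ∈ slitPlane) :
    AnalyticAt ℂ (fun z => quot z - (a + b * z)) z :=
  (quot_analytic z hz).sub (by fun_prop)

theorem deriv_quot_sub_affine {z : ℂ} (hz : z ∈ slitPlane) :
    deriv (fun z => quot z - (a + b * z)) z = deriv quot z - b := by
  have h1 : HasDerivAt (fun z : ℂ => (a : ℂ) + b * z) b z :=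
    (((hasDerivAt_id z).const_mul (b : ℂ)).const_add (a : ℂ)).congr_deriv (by ring)
  exact ((quot_analytic z hz).differentiableAt.hasDerivAt.sub h1).deriv

theorem quot_eq_affine_of_order_ne_zero {z : ℂ} (hz : z ∈ slitPlane)
    (h : analyticOrderAt (fun z => quot z - (a + b * z)) z ≠ 0) : quot z = a + b * z := by
  rw [Ne, (quot_sub_affine_analyticAt a b hz).analyticOrderAt_eq_zero, not_not] at h
  exact sub_eq_zero.1 h

theorem exists_slope {x y : ℝ} (hx : 0 < x) (hxy : x < y) (h1 : quot x = a + b * x)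
    (h2 : quot y = a + b * y) : ∃ ξ ∈ Ioo x y, quotSlope ξ = b := by
  obtain ⟨ξ, hξ, hs⟩ := exists_hasDerivAt_eq_slope (fun x : ℝ => (quot x).re) quotSlope hxy
    (fun z hz => (hasDerivAt_quot_re (hx.trans_le hz.1)).continuousAt.continuousWithinAt)
    (fun z hz => hasDerivAt_quot_re (hx.trans hz.1))
  refine ⟨ξ, hξ, ?_⟩
  have h3 : ∀ t : ℝ, ((a : ℂ) + b * t).re = a + b * t := fun t => by simp
  rw [hs, h1, h2, h3, h3, div_eq_iff (by linarith)]
  ring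

theorem slope_injective {ξ η : ℝ} (hξ : 0 < ξ) (hη : 0 < η) (h1 : quotSlope ξ = b)
    (h2 : quotSlope η = b) : ξ = η :=
  quotSlope_strictAntiOn.injOn hξ hη (h1.trans h2.symm)

/-- Otherwise `quot` would be affine on the positive axis by the identity theorem, against the
strict monotonicity of its slope. -/
theorem exists_quot_ne_affine : ∃ z : ℂ, 0 < z.im ∧ quot z ≠ a + b * z := by
  by_contra! h
  have heq : EqOn quot (fun z => a + b * z) slitPlane := by
    refine quot_analytic.eqOn_of_preconnected_of_eventuallyEq
      (fun z _ => by fun_prop)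
      (starConvex_one_slitPlane.isPathConnected one_mem_slitPlane).isConnected.isPreconnected
      (z₀ := I) (Or.inr (by simp)) ?_
    filter_upwards [(isOpen_lt continuous_const continuous_im).mem_nhds
      (show (0 : ℝ) < I.im by simp)] with z hz using h z hz
  have h1 := fun x (hx : (0 : ℝ) < x) => heq (ofReal_mem hx)
  obtain ⟨ξ, hξ, hξ1⟩ := exists_slope a b one_pos one_lt_two (h1 1 one_pos) (h1 2 two_pos)
  obtain ⟨η, hη, hη1⟩ := exists_slope a b two_pos (show (2 : ℝ) < 3 by norm_num)
    (h1 2 two_pos) (h1 3 three_pos)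
  have := slope_injective b (one_pos.trans hξ.1) (two_pos.trans hη.1) hξ1 hη1
  linarith [hξ.2, hη.1]

theorem sum_order_upper {S : Finset ℂ} (hS : ∀ z ∈ S, 0 < z.im) :
    ∑ z ∈ S, analyticOrderAt (fun z => quot z - (a + b * z)) z ≤ 1 := by
  have hd : DifferentiableOn ℂ quot {z | 0 < z.im} :=
    quot_analytic.differentiableOn.mono fun z hz => Or.inr (ne_of_gt hz)
  have key := fun z hz hPz => affine_intersection hd (fun _ => quot_im_pos)
    (exists_quot_ne_affine a b) (z := z) hz hPz
  have hm : ∀ z ∈ S, z ∈ slitPlane := fun z hz => Or.inr (hS z hz).ne'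
  refine sum_le_one_of_subsingleton (fun z hz => ?_) fun z hz w hw h1 h2 => ?_
  · refine analyticOrderAt_le_one (quot_sub_affine_analyticAt a b (hm z hz)) fun h => ?_
    rw [deriv_quot_sub_affine a b (hm z hz), sub_ne_zero]
    exact (key z (hS z hz) (sub_eq_zero.1 h)).1
  · exact (key w (hS w hw) (quot_eq_affine_of_order_ne_zero a b (hm w hw) h2)).2 z (hS z hz)
      (quot_eq_affine_of_order_ne_zero a b (hm z hz) h1)

/-- The map `z ↦ -quot (-z)` carries the upper half plane into itself and meets `-a + b z` at the
negatives of the intersections below the axis. -/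
theorem sum_order_lower {S : Finset ℂ} (hS : ∀ z ∈ S, z.im < 0) :
    ∑ z ∈ S, analyticOrderAt (fun z => quot z - (a + b * z)) z ≤ 1 := by
  have hm' : ∀ z : ℂ, 0 < z.im → -z ∈ slitPlane := fun z hz => Or.inr (by simpa using hz.ne')
  have hd : ∀ z : ℂ, 0 < z.im → HasDerivAt (fun z => -quot (-z)) (deriv quot (-z)) z :=
    fun z hz => by
    have h1 := (quot_analytic _ (hm' z hz)).differentiableAt.hasDerivAt
    exact (h1.comp z (hasDerivAt_neg z)).neg.congr_deriv (by ring)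
  have hne : ∃ z : ℂ, 0 < z.im ∧ -quot (-z) ≠ (-a : ℝ) + b * z := by
    obtain ⟨z, hz, h⟩ := exists_quot_ne_affine a b
    refine ⟨-conj z, by simpa using hz, fun h1 => h ?_⟩
    rw [neg_neg, quot_conj (Or.inr hz.ne')] at h1
    have h2 := congrArg conj h1
    simp only [map_neg, conj_conj, map_add, map_mul, conj_ofReal] at h2
    push_cast at h2
    linear_combination -h2
  have key := fun z hz hPz => affine_intersection
    (fun z hz => (hd z hz).differentiableAt.differentiableWithinAt)
    (fun z hz => by
      have := quot_im_neg (h := -z) (by simpa using hz)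
      simpa using this) hne (z := z) hz hPz
  have hm : ∀ z ∈ S, z ∈ slitPlane := fun z hz => Or.inr (hS z hz).ne
  have hneg : ∀ z ∈ S, 0 < (-z).im := fun z hz => by simpa using hS z hz
  have hiff : ∀ z : ℂ, quot z = a + b * z → -quot (- -z) = (-a : ℝ) + b * (-z) := fun z h => by
    rw [neg_neg, h]
    push_cast
    ring
  refine sum_le_one_of_subsingleton (fun z hz => ?_) fun z hz w hw h1 h2 => ?_
  · refine analyticOrderAt_le_one (quot_sub_affine_analyticAt a b (hm z hz)) fun h => ?_
    have h1 := (key (-z) (hneg z hz) (hiff z (sub_eq_zero.1 h))).1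
    rw [(hd _ (hneg z hz)).deriv, neg_neg] at h1
    rwa [deriv_quot_sub_affine a b (hm z hz), sub_ne_zero]
  · exact neg_injective ((key (-w) (hneg w hw)
      (hiff w (quot_eq_affine_of_order_ne_zero a b (hm w hw) h2))).2 (-z) (hneg z hz)
      (hiff z (quot_eq_affine_of_order_ne_zero a b (hm z hz) h1)))

/-- By the mean value theorem the slope equals `b` strictly between two intersections, and by
concavity nowhere else. This excludes a third intersection, and tangency at either of two. -/
theorem sum_order_real {S : Finset ℂ} (hS : ∀ z ∈ S, ∃ x : ℝ, 0 < x ∧ (x : ℂ) = z) :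
    ∑ z ∈ S, analyticOrderAt (fun z => quot z - (a + b * z)) z ≤ 2 := by
  have hdd : ∀ x : ℝ, 0 < x → deriv (deriv fun z => quot z - (a + b * z)) x ≠ 0 := fun x hx => by
    have : deriv (fun z => quot z - (a + b * z)) =ᶠ[𝓝 (x : ℂ)] fun z => deriv quot z - b := by
      filter_upwards [isOpen_slitPlane.mem_nhds (ofReal_mem hx)] with z hz
      exact deriv_quot_sub_affine a b hz
    rw [this.deriv_eq, deriv_sub_const]
    exact deriv_deriv_quot_ne_zero hx
  have hzero : ∀ x : ℝ, 0 < x → analyticOrderAt (fun z => quot z - (a + b * z)) x ≠ 0 →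
      quot x = a + b * x := fun x hx => quot_eq_affine_of_order_ne_zero a b (ofReal_mem hx)
  refine sum_le_two (fun z hz => ?_) (fun z hz w hw hzw h1 h2 => ?_)
    (fun x hxS y hyS z hzS hxy hxz hyz h1 h2 h3 => ?_)
  · obtain ⟨x, hx, rfl⟩ := hS z hz
    exact analyticOrderAt_le_two (quot_sub_affine_analyticAt a b (ofReal_mem hx)) (hdd x hx)
  · obtain ⟨x, hx, rfl⟩ := hS z hz
    obtain ⟨y, hy, rfl⟩ := hS w hw
    refine analyticOrderAt_le_one (quot_sub_affine_analyticAt a b (ofReal_mem hx)) fun h h0 => ?_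
    rw [deriv_quot_sub_affine a b (ofReal_mem hx), deriv_quot_ofReal hx, sub_eq_zero] at h0
    have h0 : quotSlope x = b := by exact_mod_cast h0
    rcases lt_trichotomy x y with hlt | heq | hlt
    · obtain ⟨ξ, hξ, hξb⟩ := exists_slope a b hx hlt (hzero x hx h1) (hzero y hy h2)
      exact hξ.1.ne (slope_injective b hx (hx.trans hξ.1) h0 hξb)
    · exact hzw (by rw [heq])
    · obtain ⟨ξ, hξ, hξb⟩ := exists_slope a b hy hlt (hzero y hy h2) (hzero x hx h1)
      exact hξ.2.ne (slope_injective b (hy.trans hξ.1) hx hξb h0)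
  · obtain ⟨x, hx, rfl⟩ := hS x hxS
    obtain ⟨y, hy, rfl⟩ := hS y hyS
    obtain ⟨z, hz, rfl⟩ := hS z hzS
    have key : ∀ x y z : ℝ, 0 < x → x < y → y < z → quot x = a + b * x → quot y = a + b * y →
        quot z = a + b * z → False := fun x y z hx hxy hyz h1 h2 h3 => by
      obtain ⟨ξ, hξ, hξb⟩ := exists_slope a b hx hxy h1 h2
      obtain ⟨η, hη, hηb⟩ := exists_slope a b (hx.trans hxy) hyz h2 h3
      exact (hξ.2.trans hη.1).ne
        (slope_injective b (hx.trans hξ.1) ((hx.trans hxy).trans hη.1) hξb hηb)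
    have h1 := hzero x hx h1
    have h2 := hzero y hy h2
    have h3 := hzero z hz h3
    rw [Ne, ofReal_inj] at hxy hxz hyz
    rcases lt_or_gt_of_ne hxy with h | h <;> rcases lt_or_gt_of_ne hxz with h' | h' <;>
      rcases lt_or_gt_of_ne hyz with h'' | h''
    · exact key x y z hx h h'' h1 h2 h3
    · exact key x z y hx h' h'' h1 h3 h2
    · linarith
    · exact key z x y hz h' h h3 h1 h2
    · exact key y x z hy h h' h2 h1 h3
    · linarith
    · exact key y z x hy h'' h' h2 h3 h1
    · exact key z y x hz h'' h h3 h2 h1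

theorem sum_order_le_four {S : Finset ℂ} (hS : (S : Set ℂ) ⊆ slitPlane) :
    ∑ z ∈ S, analyticOrderAt (fun z => quot z - (a + b * z)) z ≤ 4 := by
  rw [← Finset.sum_filter_add_sum_filter_not S (fun z => 0 < z.im),
    ← Finset.sum_filter_add_sum_filter_not (S.filter fun z => ¬ 0 < z.im) (fun z => z.im < 0)]
  have h1 := sum_order_upper a b (S := S.filter fun z => 0 < z.im)
    fun z hz => (Finset.mem_filter.1 hz).2
  have h2 := sum_order_lower a b (S := (S.filter fun z => ¬ 0 < z.im).filter fun z => z.im < 0)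
    fun z hz => (Finset.mem_filter.1 hz).2
  have h3 := sum_order_real a b
    (S := (S.filter fun z => ¬ 0 < z.im).filter fun z => ¬ z.im < 0) fun z hz => by
      simp only [Finset.mem_filter, not_lt] at hz
      have him : z.im = 0 := le_antisymm hz.1.2 hz.2
      refine ⟨z.re, ?_, Complex.ext rfl (by simp [him])⟩
      have := hS hz.1.1
      simpa [mem_slitPlane_iff, him] using this
  calc _ ≤ (1 : ℕ∞) + (1 + 2) := add_le_add h1 (add_le_add h2 h3)
    _ = 4 := by norm_num

end Affine

/-! ### Reduction of `M` to the quotient. -/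

theorem principalPart_eventuallyEq {I0 I2 I4 : ℂ → ℂ} (h0 : IsAbelianIntegral 0 I0)
    (h2 : IsAbelianIntegral 2 I2) (h4 : IsAbelianIntegral 4 I4) (l0 l2 l4 : ℝ) {z : ℂ}
    (hz : z ∈ slitPlane) :
    principalPart l0 l2 l4 I0 I2 I4 =ᶠ[𝓝 z] fun z => deriv (ovalExt 2) z *
      ((l0 + l2 / 5 + l4 : ℝ) * quot z + ((l4 + l2 / 5 : ℝ) + (4 * l2 / 5 : ℝ) * z)) := by
  filter_upwards [isOpen_slitPlane.mem_nhds hz] with w hw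
  have e0 := h0.eqOn (isAbelianIntegral_ovalExt 0) hw
  have e2 := h2.eqOn (isAbelianIntegral_ovalExt 2) hw
  have e4 : deriv I4 w = deriv (ovalExt 4) w :=
    Filter.EventuallyEq.deriv_eq (Filter.eventuallyEq_of_mem (isOpen_slitPlane.mem_nhds hw)
      (h4.eqOn (isAbelianIntegral_ovalExt 4)))
  have hr := deriv_ovalExt_two_relation hw
  have hq : quot w * deriv (ovalExt 2) w = ovalExt 0 w :=
    div_mul_cancel₀ _ (deriv_ovalExt_two_ne_zero hw)
  rw [principalPart, e0, e2, e4, deriv_ovalExt_four hw]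
  push_cast
  linear_combination (-(l2 / 5 : ℂ)) * hr - (l0 + l2 / 5 + l4 : ℂ) * hq

theorem analyticOrderAt_mul_of_ne_zero {f g : ℂ → ℂ} {z : ℂ} (hf : AnalyticAt ℂ f z)
    (hg : AnalyticAt ℂ g z) (h : f z ≠ 0) :
    analyticOrderAt (fun z => f z * g z) z = analyticOrderAt g z := by
  have := analyticOrderAt_mul hf hg
  rwa [hf.analyticOrderAt_eq_zero.2 h, zero_add] at this

theorem sum_order_affine_le_one {u v : ℝ} (h : ¬(u = 0 ∧ v = 0)) (S : Finset ℂ) :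
    ∑ z ∈ S, analyticOrderAt (fun z : ℂ => (u : ℂ) + v * z) z ≤ 1 := by
  have han : ∀ z : ℂ, AnalyticAt ℂ (fun z : ℂ => (u : ℂ) + v * z) z := fun z => by fun_prop
  have hv : ∀ z : ℂ, (u : ℂ) + v * z = 0 → (v : ℂ) ≠ 0 := fun z h1 h2 => by
    rw [h2, zero_mul, add_zero] at h1
    exact h ⟨by exact_mod_cast h1, by exact_mod_cast h2⟩
  refine sum_le_one_of_subsingleton (fun z _ => ?_) fun z _ w _ h1 h2 => ?_
  · refine analyticOrderAt_le_one (han z) fun h1 => ?_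
    have : HasDerivAt (fun z : ℂ => (u : ℂ) + v * z) v z :=
      (((hasDerivAt_id z).const_mul (v : ℂ)).const_add (u : ℂ)).congr_deriv (by ring)
    rw [this.deriv]
    exact hv z h1
  · rw [Ne, (han _).analyticOrderAt_eq_zero, not_not] at h1 h2
    exact mul_left_cancel₀ (hv z h1) (add_left_cancel (h1.trans h2.symm))

end Duffing

theorem lemmaz3 :
    (∀ n : ℕ, ∃ I : ℂ → ℂ, IsAbelianIntegral n I) ∧
    ∀ I0 I2 I4 : ℂ → ℂ,
      IsAbelianIntegral 0 I0 → IsAbelianIntegral 2 I2 → IsAbelianIntegral 4 I4 →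
      ∀ l0 l2 l4 : ℝ, ¬ (l0 = 0 ∧ l2 = 0 ∧ l4 = 0) →
        zeroCount (principalPart l0 l2 l4 I0 I2 I4) Complex.slitPlane ≤ 4 := by
  refine ⟨fun n => ⟨_, Duffing.isAbelianIntegral_ovalExt n⟩,
    fun I0 I2 I4 h0 h2 h4 l0 l2 l4 hl => iSup_le fun ⟨S, hS⟩ => ?_⟩
  set α := l0 + l2 / 5 + l4 with hα
  set β := l4 + l2 / 5 with hβ
  set γ := 4 * l2 / 5 with hγ
  have hord : ∀ z ∈ S, analyticOrderAt (principalPart l0 l2 l4 I0 I2 I4) z =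
      analyticOrderAt (fun z => α * Duffing.quot z + (β + γ * z)) z := fun z hz => by
    have hz := hS hz
    rw [analyticOrderAt_congr (Duffing.principalPart_eventuallyEq h0 h2 h4 l0 l2 l4 hz)]
    refine Duffing.analyticOrderAt_mul_of_ne_zero
      ((Duffing.isAbelianIntegral_ovalExt 2).analytic z hz).deriv ?_
      (Duffing.deriv_ovalExt_two_ne_zero hz)
    exact (analyticAt_const.mul (Duffing.quot_analytic z hz)).add (by fun_prop)
  rw [Finset.sum_congr rfl hord]
  rcases eq_or_ne α 0 with h | h
  -- The linear map from the `λ`'s to `(α, β, γ)` is injective, so the remaining affine function is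
  -- not zero.
  · have hne : ¬(β = 0 ∧ γ = 0) := fun ⟨h1, h2⟩ => hl ⟨by linarith, by linarith, by linarith⟩
    simp only [h, Complex.ofReal_zero, zero_mul, zero_add]
    exact (Duffing.sum_order_affine_le_one hne S).trans (by norm_num)
  · have hα0 : (α : ℂ) ≠ 0 := by exact_mod_cast h
    have hord2 : ∀ z ∈ S, analyticOrderAt (fun z => α * Duffing.quot z + (β + γ * z)) z =
        analyticOrderAt (fun z => Duffing.quot z - ((-β / α : ℝ) + (-γ / α : ℝ) * z)) z :=
      fun z hz => by
      rw [← Duffing.analyticOrderAt_mul_of_ne_zero (f := fun _ => (α : ℂ)) analyticAt_const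
        (Duffing.quot_sub_affine_analyticAt _ _ (hS hz)) hα0]
      congr 1
      funext w
      push_cast
      field_simp
      ring
    rw [Finset.sum_congr rfl hord2]
    exact Duffing.sum_order_le_four _ _ hS
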